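/- **Notation.** Let $\mathbb F_q$ be a finite field, $\mathbb F_{q^m}$ its extension of degree $m$, and $\theta:x\mapsto x^q$ the $q$-Frobenius automorphism of $\mathbb F_{q^m}$. Let $k,n$ be integers with $0<k<n\le m$ and let $s$ be an integer coprime to $m$. The $q$-rank $\mathrm{rk}_q(g)$ of a vector $g$ over $\mathbb F_{q^m}$ is the $\mathbb F_q$-dimension of the $\mathbb F_q$-span of its entries. For $g\in\mathbb F_{q^m}^n$ with $\mathrm{rk}_q(g)=n$, the generalized Gabidulin code of parameter $s$ is $$\mathcal G_{k,s}(g)=\{(f(g_1),\dots,f(g_n)) \mid f=\textstyle\sum_{i=0}^{k-1} f_i\,\theta^{si},\ f_i\in\mathbb F_{q^m}\},$$ and $\mathrm{Gab}_q(k,n,m,s)$ is the set of all $k$-dimensional subspaces of $\mathbb F_{q^m}^n$ of this form. For $X=(x_{i,j})\in\mathbb F_{q^m}^{k\times(n-k)}$ let $\mathcal C_X$ be the row space of $(I_k\mid X)$, and let $\Phi_s(X)=\theta^s(X)-X$, with $\theta^s$ applied to every entry. **Theorem.** (a) (Criterion I) For every $X\in\mathbb F_{q^m}^{k\times(n-k)}$,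 $\mathcal C_X\in\mathrm{Gab}_q(k,n,m,s)$ if and only if (i) the first row of $\Phi_s(X)$ has $q$-rank $n-k$, (ii) the first column of $\Phi_s(X)$ has $q$-rank $k$, and (iii) $\mathrm{rk}(\Phi_s(X))=1$. (b) (Criterion II) For every $X\in\mathbb F_{q^m}^{k\times(n-k)}$, $\mathcal C_X\in\mathrm{Gab}_q(k,n,m,s)$ if and only if (i') $\mathrm{rk}_q(1,x_{1,1},\dots,x_{1,n-k})=n-k+1$, (ii') $\mathrm{rk}_q(1,x_{1,1},\dots,x_{k,1})=k+1$, and (iii) $\mathrm{rk}(\Phi_s(X))=1$. (c) (Cost) For fixed $q$, it can be decided with $\mathcal O(m\cdot F(k,n))$ operations in $\mathbb F_{q^m}$ whether the code generated by the rows of a given matrix $G\in\mathbb F_{q^m}^{k\times n}$ belongs to $\mathrm{Gab}_q(k,n,m,s)$. Here $F(k,n)$ is the least worst-case number of operations in $\mathbb F_{q^m}$ with which the reduced row echelon form of a $k\times n$ matrix over $\mathbb F_{q^m}$ can be computed. More precisely, there is an absolute constant $C$ such that, for all $\mathbb F_q$, $\mathbb F_{q^m}$, $k$, $n$, $s$ as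 above, there is an algebraic computation tree over $\mathbb F_{q^m}$ that decides this for every $G\in\mathbb F_{q^m}^{k\times n}$ in at most $C\,\lfloor\log_2 q\rfloor\, m\, F(k,n)$ steps. A step, also in the definition of $F(k,n)$, is an addition, subtraction, multiplication, division (where $x/0=0$) or zero test in $\mathbb F_{q^m}$, or the writing of a constant. -/

import Mathlib

/-! ### Generalized Gabidulin codes

`F` is the finite field with `q` elements, `K` a finite extension of degree `m`. -/

noncomputable section

namespace Gabidulin

section Codes

variable (F : Type*) {K : Type*} [Field F] [Field K] [Algebra F K]

/-- The `q`-rank of a vector `g`: the `F`-dimension of the `F`-span of its entries. -/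
def qRank {ι : Type*} (g : ι → K) : ℕ :=
  Module.finrank F (Submodule.span F (Set.range g))

/-- The row space over `K` of a matrix, that is, the code of which it is a generator matrix. -/
def rowSpace {k n : ℕ} (G : Matrix (Fin k) (Fin n) K) : Submodule K (Fin n → K) :=
  Submodule.span K (Set.range fun i => G i)

/-- The matrix `(I_k | X)`. -/
def standardForm {k r : ℕ} (X : Matrix (Fin k) (Fin r) K) : Matrix (Fin k) (Fin (k + r)) K :=
  fun i => Fin.append ((1 : Matrix (Fin k) (Fin k) K) i) (X i)

/-- The code `C_X` generated by `(I_k | X)`. -/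
def codeOf {k r : ℕ} (X : Matrix (Fin k) (Fin r) K) : Submodule K (Fin (k + r) → K) :=
  rowSpace (standardForm X)

variable [Fintype F] [Finite K]

variable (K) in
/-- `θ ^ s`, where `θ : x ↦ x ^ q` is the `q`-Frobenius automorphism of `K` over `F`; the integer
`s` may be negative. -/
def theta (s : ℤ) : K ≃ₐ[F] K :=
  (FiniteField.frobeniusAlgEquivOfAlgebraic F K) ^ s

/-- For `s ≥ 0`, `θ ^ s` is `x ↦ x ^ [s]` with `[s] = q ^ s`. -/
theorem theta_natCast (s : ℕ) (x : K) : theta F K (s : ℤ) x = x ^ (Fintype.card F ^ s) := by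
  rw [theta, zpow_natCast, AlgEquiv.coe_pow,
    FiniteField.coe_frobeniusAlgEquivOfAlgebraic_iterate]

/-- The map `Φ_s : X ↦ θ ^ s (X) - X`, with `θ ^ s` applied to every entry. -/
def Phi {k r : ℕ} (s : ℤ) (X : Matrix (Fin k) (Fin r) K) : Matrix (Fin k) (Fin r) K :=
  X.map (theta F K s) - X

variable (K) in
/-- The space `G_{k,s}` of linearized polynomials `f_0 x + f_1 x^[s] + ⋯ + f_{k-1} x^[s(k-1)]`
with coefficients in `K`. Linearized polynomials are taken modulo `x^(q^m) - x`, i.e. they are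
functions `K → K`, and `x^[j] = θ ^ j (x)`. -/
def linPoly (k : ℕ) (s : ℤ) : Set (K → K) :=
  {f | ∃ c : Fin k → K, f = fun x => ∑ i : Fin k, c i * theta F K (s * (i : ℤ)) x}

/-- The generalized Gabidulin code `G_{k,s}(g) = {(f(g_1), …, f(g_n)) | f ∈ G_{k,s}}`, as a set. -/
def gabCode (k : ℕ) {n : ℕ} (s : ℤ) (g : Fin n → K) : Set (Fin n → K) :=
  {c | ∃ f ∈ linPoly F K k s, c = fun j => f (g j)}

variable (K) in
/-- `Gab_q(k, n, m, s)`: the `k`-dimensional codes `U ⊆ K ^ n` that are generalized Gabidulin codes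
of parameter `s`. -/
def Gab (k n : ℕ) (s : ℤ) : Set (Submodule K (Fin n → K)) :=
  {U | Module.finrank K U = k ∧
    ∃ g : Fin n → K, qRank F g = n ∧ (U : Set (Fin n → K)) = gabCode F k s g}

end Codes

/-! ### Counting field operations

Computations over a field `K` on inputs of a fixed size: algebraic computation trees, written as
branching programs acting on registers. -/

/-- The four field operations. -/
inductive FieldOp
  | add
  | sub
  | mul
  | div

/-- The value of a field operation; division by zero returns zero. -/
def FieldOp.eval {K : Type*} [Field K] : FieldOp → K → K → K
  | .add, x, y => x + y
  | .sub, x, y => x - y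
  | .mul, x, y => x * y
  | .div, x, y => x / y

/-- Programs over `K` with registers indexed by `ρ` and results in `β`. -/
inductive Prog (K ρ β : Type*)
  /-- Stop and return `b`. -/
  | halt (b : β) : Prog K ρ β
  /-- Write the constant `c` into register `d`, then continue. -/
  | const (d : ρ) (c : K) (next : Prog K ρ β) : Prog K ρ β
  /-- Write the result of the operation `o` on the contents of the registers `a` and `b` into
  register `d`, then continue. -/
  | op (d : ρ) (o : FieldOp) (a b : ρ) (next : Prog K ρ β) : Prog K ρ β
  /-- Continue with `yes` if register `a` contains zero, and with `no` otherwise. -/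
  | ifZero (a : ρ) (yes no : Prog K ρ β) : Prog K ρ β

section Programs

variable {K ρ β : Type*} [Field K] [DecidableEq ρ]

open Classical in
/-- Running a program on register contents `v`: the final register contents and the result. -/
def Prog.run : Prog K ρ β → (ρ → K) → (ρ → K) × β
  | .halt b, v => (v, b)
  | .const d c next, v => next.run (Function.update v d c)
  | .op d o a b next, v => next.run (Function.update v d (o.eval (v a) (v b)))
  | .ifZero a yes no, v => if v a = 0 then yes.run v else no.run v

open Classical in
/-- The number of steps (constants, field operations and zero tests) executed on register
contents `v`. -/
def Prog.cost : Prog K ρ β → (ρ → K) → ℕ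
  | .halt _, _ => 0
  | .const d c next, v => next.cost (Function.update v d c) + 1
  | .op d o a b next, v => next.cost (Function.update v d (o.eval (v a) (v b))) + 1
  | .ifZero a yes no, v => (if v a = 0 then yes.cost v else no.cost v) + 1

end Programs

/-- The registers of a program whose input is a `k × n` matrix: one for every entry of the matrix,
and scratch registers indexed by `ℕ`. -/
abbrev Reg (k n : ℕ) : Type := (Fin k × Fin n) ⊕ ℕ

section MatrixPrograms

variable {K : Type*} [Field K] {k n : ℕ}

/-- The initial register contents on input `M`; the scratch registers contain zero. -/
def load (M : Matrix (Fin k) (Fin n) K) : Reg k n → K :=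
  Sum.elim (fun p => M p.1 p.2) (fun _ => 0)

/-- The matrix contained in the matrix registers. -/
def readMatrix (v : Reg k n → K) : Matrix (Fin k) (Fin n) K :=
  fun i j => v (Sum.inl (i, j))

/-- `P` executes at most `T` steps on every `k × n` input matrix. -/
def CostAtMost {β : Type*} (P : Prog K (Reg k n) β) (T : ℕ) : Prop :=
  ∀ M : Matrix (Fin k) (Fin n) K, P.cost (load M) ≤ T

/-- `P` replaces every `k × n` matrix by its reduced row echelon form. -/
def ComputesRREF (P : Prog K (Reg k n) Unit) : Prop :=
  ∀ M : Matrix (Fin k) (Fin n) K,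
    (readMatrix (P.run (load M)).1).IsReducedRowEchelon ∧
      rowSpace (readMatrix (P.run (load M)).1) = rowSpace M

variable (K k n) in
/-- `F(k, n)`: the worst-case number of steps over `K` that is needed to compute the reduced row
echelon form of a `k × n` matrix. -/
def rrefCost : ℕ :=
  sInf {T | ∃ P : Prog K (Reg k n) Unit, ComputesRREF P ∧ CostAtMost P T}

/-- `P` decides, for every `k × n` matrix `G`, whether the code generated by `G` is in the set `S`
of codes. -/
def Decides (P : Prog K (Reg k n) Bool) (S : Set (Submodule K (Fin n → K))) : Prop :=
  ∀ G : Matrix (Fin k) (Fin n) K, (P.run (load G)).2 = true ↔ rowSpace G ∈ S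

end MatrixPrograms

end Gabidulin

end

/-! Put `σ = θ^s`. Coprimality makes `F` its fixed field, so `σ - 1` is `F`-linear with kernel `F`.
Hence a `σ`-polynomial with `d` coefficients, not all zero, cannot vanish at `d` independent
elements (`coeff_eq_zero_of_roots`) nor take values in `F` at `d + 1` of them
(`coeff_eq_zero_of_values`).

If `C_X` is the Gabidulin code of `g = (u, y)`, then `σ^i(y) = σ^i(u) X` for `i < k`. Comparing
consecutive relations shows that `σ(u), …, σ^(k-1)(u)` annihilate `σ(X) - X` from the left, so this
matrix is a column `a` times a row `b`; the facts above make `a` and `b` independent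
(`exists_factors_of_codeOf_eq`). Conversely, given such factors, choose an independent `u` with
`σ^i(u) · a = 0` for `0 < i < k`; then `g = (u, uX)` generates `C_X`
(`exists_codeOf_eq_of_factors`). Independent factors amount to rank one with independent first row
and column, which is Criterion I. Criterion II follows because `σ - 1` has kernel `F`.

For the cost, an echelon form generating a Gabidulin code must be `(I | X)`. Then `σ(X) - X` is
computed by iterated `q`-th powers, rank one becomes a system of quadratic equations, and
independence is tested by elimination with `θ - 1`. Some input forces every entry to be rewritten,
so `kn ≤ F(k, n)`, and this absorbs the cost of all these tests. -/

namespace Gabidulin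

open scoped Matrix

/-! ### Independence over the fixed field and zeros of `σ`-polynomials. -/

section Algebra

variable {F K : Type*} [Field F] [Field K] [Algebra F K]

theorem qRank_eq_iff_linearIndependent {n : ℕ} (g : Fin n → K) :
    qRank F g = n ↔ LinearIndependent F g := by
  rw [linearIndependent_iff_card_eq_finrank_span, Fintype.card_fin, eq_comm]
  rfl

/-- The fixed field of the automorphism `σ` is `F`. -/
def FixesOnlyBase (σ : K ≃ₐ[F] K) : Prop :=
  ∀ x, σ x = x → ∃ c, algebraMap F K c = x

theorem FixesOnlyBase.symm {σ : K ≃ₐ[F] K} (hσ : FixesOnlyBase σ) : FixesOnlyBase σ.symm :=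
  fun x hx => hσ x (by rw [AlgEquiv.symm_apply_eq] at hx; exact hx.symm)

/-- `σ - 1` is `F`-linear with kernel `F`, so relations among its values are relations among the `x
j` modulo `F · 1`. -/
theorem linearIndependent_cons_one_iff {σ : K ≃ₐ[F] K} (hσ : FixesOnlyBase σ) {d : ℕ}
    (x : Fin d → K) :
    LinearIndependent F (Fin.cons 1 x : Fin (d + 1) → K) ↔
      LinearIndependent F (fun j => σ (x j) - x j) := by
  simp only [Fintype.linearIndependent_iff, Fin.sum_univ_succ, Fin.cons_zero, Fin.cons_succ]
  constructor
  · intro h g hg i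
    obtain ⟨c, hc⟩ := hσ (∑ j, g j • x j) (by
      rw [← sub_eq_zero, map_sum, ← Finset.sum_sub_distrib, ← hg]
      exact Finset.sum_congr rfl fun j _ => by rw [map_smul, smul_sub])
    simpa using h (Fin.cons (-c) g) (by
      rw [Fin.cons_zero, ← Algebra.algebraMap_eq_smul_one, map_neg, hc]
      simp only [Fin.cons_succ]
      exact neg_add_cancel _) i.succ
  · intro h g hg
    have htail : ∀ j : Fin d, g j.succ = 0 := by
      apply h (fun j => g j.succ)
      have h1 := congrArg σ hg
      rw [map_add, map_smul, map_one, map_sum, map_zero, ← hg, add_right_inj, ← sub_eq_zero,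
        ← Finset.sum_sub_distrib] at h1
      rw [← h1]
      exact Finset.sum_congr rfl fun j _ => by rw [map_smul, smul_sub]
    intro i
    refine Fin.cases ?_ htail i
    simpa [htail, Algebra.smul_def] using hg

theorem linearIndependent_mul_left_iff {ι : Type*} {a : K} (ha : a ≠ 0) (v : ι → K) :
    LinearIndependent F (fun j => a * v j) ↔ LinearIndependent F v :=
  LinearMap.linearIndependent_iff (LinearMap.mulLeft F a) (v := v)
    (LinearMap.ker_eq_bot.mpr (mul_right_injective₀ ha))

/-- Elimination step: scaling turns `v 0` into `1`, which `σ - 1` removes. It drives both the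
induction on zeros and the independence test. -/
theorem linearIndependent_succ_iff {σ : K ≃ₐ[F] K} (hσ : FixesOnlyBase σ) {d : ℕ}
    (v : Fin (d + 1) → K) :
    LinearIndependent F v ↔
      v 0 ≠ 0 ∧ LinearIndependent F (fun j : Fin d => σ (v j.succ / v 0) - v j.succ / v 0) := by
  by_cases h0 : v 0 = 0
  · simp only [h0, ne_eq, not_true_eq_false, false_and, iff_false]
    exact fun h => h.ne_zero 0 h0
  · rw [← linearIndependent_cons_one_iff hσ, ← linearIndependent_mul_left_iff (inv_ne_zero h0)]
    simp only [ne_eq, h0, not_false_eq_true, true_and]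
    have : (fun j => (v 0)⁻¹ * v j) = (Fin.cons 1 fun j : Fin d => v j.succ / v 0) := by
      funext j
      refine Fin.cases ?_ (fun j => ?_) j
      · simp [h0]
      · simp [div_eq_inv_mul]
    rw [this]

/-- Summation by parts; when the coefficients sum to zero, it factors a `σ`-polynomial through `σ -
1`. -/
theorem sum_range_succ_eq_partial_sums (c z : ℕ → K) (d : ℕ) :
    ∑ i ∈ Finset.range (d + 1), c i * z i =
      (∑ i ∈ Finset.range (d + 1), c i) * z d -
        ∑ i ∈ Finset.range d, (∑ j ∈ Finset.range (i + 1), c j) * (z (i + 1) - z i) := by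
  induction d with
  | zero => simp
  | succ d ih =>
    rw [Finset.sum_range_succ _ (d + 1), ih, Finset.sum_range_succ c (d + 1),
      Finset.sum_range_succ (fun i => _ * (z (i + 1) - z i))]
    ring

/-- A nonzero `σ`-polynomial with `d` coefficients does not vanish on `d` elements that are
independent over the fixed field of `σ`. -/
theorem coeff_eq_zero_of_roots {σ : K ≃ₐ[F] K} (hσ : FixesOnlyBase σ) {d : ℕ} (c : ℕ → K)
    (u : Fin d → K) (hu : LinearIndependent F u)
    (h : ∀ j, ∑ i ∈ Finset.range d, c i * (σ ^ i) (u j) = 0) : ∀ i < d, c i = 0 := by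
  induction d generalizing c with
  | zero => simp
  | succ d ih =>
    obtain ⟨h0, hw⟩ := (linearIndependent_succ_iff hσ u).mp hu
    -- The substitution `x ↦ u 0 * x` makes `1` a zero, so the new coefficients sum to zero.
    let c' : ℕ → K := fun i => c i * (σ ^ i) (u 0)
    have hc' : ∀ j, ∑ i ∈ Finset.range (d + 1), c' i * (σ ^ i) (u j / u 0) = 0 := by
      intro j
      rw [← h j]
      refine Finset.sum_congr rfl fun i _ => ?_
      rw [mul_assoc, ← map_mul, mul_div_cancel₀ _ h0]
    have hd : ∑ i ∈ Finset.range (d + 1), c' i = 0 := by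
      simpa [div_self h0] using hc' 0
    have hlt := ih (fun i => ∑ j ∈ Finset.range (i + 1), c' j) _ hw (fun j => by
      have := hc' j.succ
      rw [sum_range_succ_eq_partial_sums, hd, zero_mul, zero_sub, neg_eq_zero] at this
      rw [← this]
      refine Finset.sum_congr rfl fun i _ => ?_
      rw [map_sub, pow_succ, AlgEquiv.mul_apply])
    have hpartial : ∀ i ≤ d + 1, ∑ j ∈ Finset.range i, c' j = 0 := by
      intro i hi
      rcases i with _ | i
      · simp
      rcases (Nat.le_of_succ_le_succ hi).lt_or_eq with h | rfl
      · exact hlt i h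
      · exact hd
    intro i hi
    have : c' i = 0 := by
      have := hpartial (i + 1) hi
      rwa [Finset.sum_range_succ, hpartial i hi.le, zero_add] at this
    exact (mul_eq_zero.mp this).resolve_right ((map_ne_zero (σ ^ i)).mpr h0)

/-- A nonzero `σ`-polynomial with `d` coefficients does not take values in the fixed field of `σ`
at `d + 1` independent elements. -/
theorem coeff_eq_zero_of_values {σ : K ≃ₐ[F] K} (hσ : FixesOnlyBase σ) {d : ℕ} (c : ℕ → K)
    (u : Fin (d + 1) → K) (hu : LinearIndependent F u)
    (h : ∀ j, ∃ e, ∑ i ∈ Finset.range d, c i * (σ ^ i) (u j) = algebraMap F K e) :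
    ∀ i < d, c i = 0 := by
  -- The coefficients of `σ ∘ f - f`, which vanishes wherever `f` takes values in `F`. Once they are
  -- zero, `c 0 = 0` and `c i = σ (c (i - 1))`.
  let b : ℕ → K := fun i => (if i = 0 then 0 else σ (c (i - 1))) - if i < d then c i else 0
  have hb := coeff_eq_zero_of_roots hσ b u hu (fun j => by
    obtain ⟨e, he⟩ := h j
    have h1 : σ (∑ i ∈ Finset.range d, c i * (σ ^ i) (u j)) =
        ∑ i ∈ Finset.range d, c i * (σ ^ i) (u j) := by rw [he, AlgEquiv.commutes]
    rw [← sub_eq_zero, map_sum] at h1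
    rw [← h1]
    simp only [b, sub_mul, Finset.sum_sub_distrib]
    congr 1
    · rw [Finset.sum_range_succ']
      simp [pow_succ']
    · rw [Finset.sum_range_succ]
      simp only [lt_irrefl, if_false, zero_mul, add_zero]
      exact Finset.sum_congr rfl fun i hi => by rw [if_pos (Finset.mem_range.mp hi)])
  intro i
  induction i with
  | zero =>
    intro hi
    simpa [b, hi] using hb 0 (by omega)
  | succ i ih =>
    intro hi
    simpa [b, hi, ih (by omega)] using hb (i + 1) (by omega)

/-- The Moore matrix of `u`, with rows `σ ^ i (u)`. -/
def moore (σ : K ≃ₐ[F] K) {k : ℕ} (u : Fin k → K) : Matrix (Fin k) (Fin k) K :=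
  Matrix.of fun i j => (σ ^ (i : ℕ)) (u j)

theorem isUnit_moore {σ : K ≃ₐ[F] K} (hσ : FixesOnlyBase σ) {k : ℕ} {u : Fin k → K}
    (hu : LinearIndependent F u) : IsUnit (moore σ u) := by
  rw [← Matrix.linearIndependent_rows_iff_isUnit, Fintype.linearIndependent_iff]
  intro g hg i
  have := coeff_eq_zero_of_roots hσ (fun i => if h : i < k then g ⟨i, h⟩ else 0) u hu (fun j => by
    have := congrFun hg j
    simp only [Finset.sum_apply, Pi.smul_apply, smul_eq_mul, Pi.zero_apply] at this
    rw [← this, Finset.sum_range]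
    exact Finset.sum_congr rfl fun i _ => by simp [moore, Matrix.row]) i i.2
  simpa using this

end Algebra

/-! ### Gabidulin codes and factorizations of `σ(X) - X`. -/

section Criterion

variable {F K : Type*} [Field F] [Field K] [Algebra F K]

theorem mem_rowSpace_iff {k n : ℕ} {G : Matrix (Fin k) (Fin n) K} {z : Fin n → K} :
    z ∈ rowSpace G ↔ ∃ w, w ᵥ* G = z := by
  simp only [rowSpace, Submodule.mem_span_range_iff_exists_fun, Matrix.vecMul_eq_sum]

theorem vecMul_standardForm {k r : ℕ} (X : Matrix (Fin k) (Fin r) K) (w : Fin k → K) :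
    w ᵥ* standardForm X = Fin.append w (w ᵥ* X) := by
  funext j
  refine Fin.addCases (fun j => ?_) (fun j => ?_) j
  · simp [Matrix.vecMul, dotProduct, standardForm, Matrix.one_apply]
  · simp [Matrix.vecMul, dotProduct, standardForm]

theorem mem_codeOf_iff {k r : ℕ} {X : Matrix (Fin k) (Fin r) K} {z : Fin (k + r) → K} :
    z ∈ codeOf X ↔ ∃ w, Fin.append w (w ᵥ* X) = z := by
  simp only [codeOf, mem_rowSpace_iff, vecMul_standardForm]

theorem finrank_codeOf {k r : ℕ} (X : Matrix (Fin k) (Fin r) K) :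
    Module.finrank K (codeOf X) = k := by
  have : LinearIndependent K (fun i => standardForm X i) := by
    rw [Fintype.linearIndependent_iff]
    intro g hg i
    rw [← Matrix.vecMul_eq_sum, vecMul_standardForm] at hg
    simpa using congrFun hg (Fin.castAdd r i)
  rw [codeOf, rowSpace, finrank_span_eq_card this, Fintype.card_fin]

/-- The generator matrix of a Gabidulin code, with rows `σ ^ i (g)`. -/
def gabGenerator (σ : K ≃ₐ[F] K) (k : ℕ) {n : ℕ} (g : Fin n → K) : Matrix (Fin k) (Fin n) K :=
  Matrix.of fun i j => (σ ^ (i : ℕ)) (g j)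

theorem exists_factors_of_codeOf_eq {σ : K ≃ₐ[F] K} (hσ : FixesOnlyBase σ) {k r : ℕ}
    (hk : 0 < k) (hr : 0 < r) {X : Matrix (Fin k) (Fin r) K} {g : Fin (k + r) → K}
    (hg : LinearIndependent F g) (hX : codeOf X = rowSpace (gabGenerator σ k g)) :
    ∃ a : Fin k → K, ∃ b : Fin r → K, LinearIndependent F a ∧ LinearIndependent F b ∧
      ∀ i j, σ (X i j) - X i j = a i * b j := by
  -- A codeword of `C_X` is determined by its first `k` entries.
  have hrow : ∀ i < k, ∀ l, (σ ^ i) (g (Fin.natAdd k l)) =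
      ∑ j, (σ ^ i) (g (Fin.castAdd r j)) * X j l := by
    intro i hi l
    have : gabGenerator σ k g ⟨i, hi⟩ ∈ codeOf X := hX ▸ Submodule.subset_span ⟨_, rfl⟩
    obtain ⟨w, hw⟩ := mem_codeOf_iff.mp this
    have h1 : ∀ j, w j = (σ ^ i) (g (Fin.castAdd r j)) := fun j => by
      simpa [gabGenerator] using congrFun hw (Fin.castAdd r j)
    have h2 := congrFun hw (Fin.natAdd k l)
    simp only [Fin.append_right, gabGenerator, Matrix.of_apply, Matrix.vecMul, dotProduct, h1] at h2
    exact h2.symm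
  have hu : LinearIndependent F (fun j => σ (g (Fin.castAdd r j))) :=
    (hg.comp _ (Fin.castAdd_injective k r)).map' σ.toLinearMap
      (LinearMap.ker_eq_bot.mpr σ.injective)
  let M := moore σ (fun j => σ (g (Fin.castAdd r j)))
  have hM : IsUnit M.det := (Matrix.isUnit_iff_isUnit_det _).mp (isUnit_moore hσ hu)
  let Y : Matrix (Fin k) (Fin r) K := Matrix.of fun i j => σ (X i j) - X i j
  let last : Fin k := ⟨k - 1, by omega⟩
  -- Apply `σ` to relation `i` and subtract relation `i + 1`; only the last row has no successor.
  have hN : ∀ i l, i ≠ last → (M * Y) i l = 0 := by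
    intro i l hi
    have hi' : (i : ℕ) + 1 < k := by
      have : (i : ℕ) ≠ k - 1 := fun h => hi (Fin.ext h)
      omega
    have h1 := congrArg σ (hrow i i.2 l)
    rw [← AlgEquiv.mul_apply, ← pow_succ', hrow _ hi', map_sum, ← sub_eq_zero,
      ← Finset.sum_sub_distrib] at h1
    rw [Matrix.mul_apply, ← neg_eq_zero, ← h1, ← Finset.sum_neg_distrib]
    refine Finset.sum_congr rfl fun j _ => ?_
    simp only [M, Y, moore, Matrix.of_apply, map_mul, ← AlgEquiv.mul_apply, ← pow_succ,
      ← pow_succ']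
    ring
  have hfac : ∀ i j, σ (X i j) - X i j = M⁻¹ i last * (M * Y) last j := by
    intro i j
    have : Y i j = (M⁻¹ * (M * Y)) i j := by rw [Matrix.nonsing_inv_mul_cancel_left _ _ hM]
    rw [show σ (X i j) - X i j = Y i j from rfl, this, Matrix.mul_apply]
    exact Finset.sum_eq_single _ (fun l _ hl => by rw [hN l j hl, mul_zero]) (by simp)
  refine ⟨fun i => M⁻¹ i last, (M * Y) last, ?_, ?_, hfac⟩
  · rw [Fintype.linearIndependent_iff]
    intro c hc
    -- A relation `c` among the entries of `a` gives `c Y = 0`, so the codeword `(c, cX)` has all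
    -- its entries in `F`.
    have hy : ∀ l, ∃ e, algebraMap F K e = ∑ i, algebraMap F K (c i) * X i l := by
      intro l
      apply hσ
      rw [← sub_eq_zero, map_sum, ← Finset.sum_sub_distrib,
        ← zero_mul ((M * Y) last l), ← hc, Finset.sum_mul]
      refine Finset.sum_congr rfl fun i _ => ?_
      rw [map_mul, AlgEquiv.commutes, ← mul_sub, hfac, Algebra.smul_def, mul_assoc]
    choose e he using hy
    have hz : Fin.append (fun i => algebraMap F K (c i)) ((fun i => algebraMap F K (c i)) ᵥ* X) ∈
        rowSpace (gabGenerator σ k g) := hX ▸ mem_codeOf_iff.mpr ⟨_, rfl⟩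
    obtain ⟨f, hf⟩ := mem_rowSpace_iff.mp hz
    have hsum : ∀ j, ∑ i ∈ Finset.range k, (if h : i < k then f ⟨i, h⟩ else 0) * (σ ^ i) (g j) =
        (f ᵥ* gabGenerator σ k g) j := by
      intro j
      rw [Finset.sum_range]
      simp [Matrix.vecMul, dotProduct, gabGenerator]
    -- `k` coefficients need `k + 1` evaluation points, available because `r > 0`.
    have hf0 := coeff_eq_zero_of_values hσ (fun i => if h : i < k then f ⟨i, h⟩ else 0)
      (fun j : Fin (k + 1) => g (Fin.castLE (by omega) j))
      (hg.comp _ (Fin.castLE_injective (by omega))) (fun j => by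
        simp only [hsum, hf]
        refine Fin.addCases (fun j => ?_) (fun j => ?_) (Fin.castLE (by omega : k + 1 ≤ k + r) j)
        · exact ⟨c j, by simp⟩
        · exact ⟨e j, by simp [Matrix.vecMul, dotProduct, he]⟩)
    have : f = 0 := funext fun i => by simpa using hf0 i i.2
    intro i
    have := congrFun hf (Fin.castAdd r i)
    rw [‹f = 0›, Matrix.zero_vecMul, Fin.append_left, Pi.zero_apply, eq_comm] at this
    simpa using this
  · rw [Fintype.linearIndependent_iff]
    intro d hd
    -- A relation `d` among the entries of `b` puts `X d` in `F^k`; then `y = uX` yields a relation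
    -- among the entries of `g`.
    have hy : ∀ i, ∃ e, algebraMap F K e = ∑ l, algebraMap F K (d l) * X i l := by
      intro i
      apply hσ
      rw [← sub_eq_zero, map_sum, ← Finset.sum_sub_distrib,
        ← mul_zero (M⁻¹ i last), ← hd, Finset.mul_sum]
      refine Finset.sum_congr rfl fun i _ => ?_
      rw [map_mul, AlgEquiv.commutes, ← mul_sub, hfac, Algebra.smul_def]
      ring
    choose e he using hy
    have := Fintype.linearIndependent_iff.mp hg (Fin.append (fun i => - e i) d) (by
      rw [Fin.sum_univ_add]
      have h0 := fun l => hrow 0 hk l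
      simp only [pow_zero, AlgEquiv.one_apply] at h0
      simp only [Fin.append_left, Fin.append_right, Algebra.smul_def, map_neg, he, h0,
        Finset.mul_sum, Finset.sum_mul, neg_mul, Finset.sum_neg_distrib]
      rw [neg_add_eq_zero, Finset.sum_comm]
      exact Finset.sum_congr rfl fun l _ => Finset.sum_congr rfl fun i _ => by ring)
    intro l
    simpa using this (Fin.natAdd k l)

/-- There are `k` equations in `k + 1` unknowns, so some `u ≠ 0` exists. A relation `c` for `u`
makes the square matrix with rows `c, τ(a), …, τ^k(a)` singular; a left kernel vector is then a
`τ`-polynomial with `k` coefficients and controlled values at the `k + 1` elements `τ (a j)`. -/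
theorem exists_independent_orthogonal {τ : K ≃ₐ[F] K} (hτ : FixesOnlyBase τ) {k : ℕ}
    {a : Fin (k + 1) → K} (ha : LinearIndependent F a) :
    ∃ u : Fin (k + 1) → K, LinearIndependent F u ∧
      ∀ i < k, ∑ j, (τ ^ (i + 1)) (a j) * u j = 0 := by
  let B : Matrix (Fin k) (Fin (k + 1)) K := Matrix.of fun i j => (τ ^ ((i : ℕ) + 1)) (a j)
  obtain ⟨u, hu, hu0⟩ := (Submodule.ne_bot_iff _).mp
    (LinearMap.ker_ne_bot_of_finrank_lt (f := B.mulVecLin) (by simp))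
  have hB : B *ᵥ u = 0 := hu
  refine ⟨u, ?_, fun i hi => congrFun hB ⟨i, hi⟩⟩
  rw [Fintype.linearIndependent_iff]
  intro c hc
  let A : Matrix (Fin (k + 1)) (Fin (k + 1)) K :=
    Fin.cons (fun j => algebraMap F K (c j)) (fun i => B i)
  have hA : A *ᵥ u = 0 := by
    funext i
    refine Fin.cases ?_ (fun i => congrFun hB i) i
    simpa [Matrix.mulVec, dotProduct, A, Algebra.smul_def] using hc
  obtain ⟨l, hl0, hl⟩ := Matrix.exists_vecMul_eq_zero_iff.mpr
    (Matrix.exists_mulVec_eq_zero_iff.mp ⟨u, hu0, hA⟩)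
  have hl' : ∀ j, l 0 * algebraMap F K (c j) +
      ∑ i : Fin k, l i.succ * (τ ^ (i : ℕ)) (τ (a j)) = 0 := by
    intro j
    have := congrFun hl j
    simpa [Matrix.vecMul, dotProduct, Fin.sum_univ_succ, A, B, pow_succ] using this
  have hτa : LinearIndependent F (fun j => τ (a j)) :=
    ha.map' τ.toLinearMap (LinearMap.ker_eq_bot.mpr τ.injective)
  -- Used with `t = 1` to exclude `l 0 = 0`, then with `t = (l 0)⁻¹` to bring the values into `F`.
  have hvan : ∀ t : K, (∀ j, ∃ e, -(t * (l 0 * algebraMap F K (c j))) = algebraMap F K e) →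
      ∀ i : Fin k, t * l i.succ = 0 := by
    intro t ht i
    have := coeff_eq_zero_of_values hτ
      (fun i => if h : i < k then t * l (Fin.succ ⟨i, h⟩) else 0) _ hτa (fun j => by
        obtain ⟨e, he⟩ := ht j
        refine ⟨e, ?_⟩
        rw [← he, ← mul_neg, neg_eq_of_add_eq_zero_right (hl' j), Finset.sum_range, Finset.mul_sum]
        exact Finset.sum_congr rfl fun i _ => by simp [mul_assoc]) i i.2
    simpa using this
  have h0 : l 0 ≠ 0 := by
    intro h0
    apply hl0
    have := hvan 1 (fun j => ⟨0, by simp [h0]⟩)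
    funext i
    exact Fin.cases h0 (fun i => by simpa using this i) i
  have hs := hvan (l 0)⁻¹ (fun j => ⟨-c j, by simp [h0]⟩)
  intro j
  have hs' : ∀ i : Fin k, l i.succ = 0 := fun i => by simpa [h0] using hs i
  simpa [hs', h0] using hl' j

theorem exists_codeOf_eq_of_factors {σ : K ≃ₐ[F] K} (hσ : FixesOnlyBase σ) {k r : ℕ}
    (hk : 0 < k) {X : Matrix (Fin k) (Fin r) K} {a : Fin k → K} {b : Fin r → K}
    (ha : LinearIndependent F a) (hb : LinearIndependent F b)
    (hab : ∀ i j, σ (X i j) - X i j = a i * b j) :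
    ∃ g : Fin (k + r) → K, LinearIndependent F g ∧
      codeOf X = rowSpace (gabGenerator σ k g) := by
  obtain ⟨k, rfl⟩ : ∃ k', k = k' + 1 := ⟨k - 1, by omega⟩
  obtain ⟨u, hu, horth⟩ := exists_independent_orthogonal hσ.symm ha
  -- Applying `σ ^ (i + 1)` moves the powers of `σ⁻¹` on `a` to powers of `σ` on `u`.
  have horth' : ∀ i < k, ∑ j, (σ ^ (i + 1)) (u j) * a j = 0 := by
    intro i hi
    have := congrArg (σ ^ (i + 1)) (horth i hi)
    rw [map_sum, map_zero] at this
    rw [← this]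
    refine Finset.sum_congr rfl fun j _ => ?_
    rw [map_mul, mul_comm, ← AlgEquiv.mul_apply, show σ.symm = σ⁻¹ from rfl, inv_pow,
      mul_inv_cancel, AlgEquiv.one_apply]
  -- The error in the inductive step is `(σ^(i+1)(u) · a) * b l = 0`.
  have hrow : ∀ i ≤ k, ∀ l, (σ ^ i) (∑ j, u j * X j l) = ∑ j, (σ ^ i) (u j) * X j l := by
    intro i
    induction i with
    | zero => simp
    | succ i ih =>
      intro hi l
      rw [pow_succ', AlgEquiv.mul_apply, ih (by omega), map_sum, ← sub_eq_zero,
        ← Finset.sum_sub_distrib, ← zero_mul (b l), ← horth' i hi, Finset.sum_mul]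
      refine Finset.sum_congr rfl fun j _ => ?_
      rw [map_mul, pow_succ', AlgEquiv.mul_apply, ← mul_sub, hab, mul_assoc]
  have hM := isUnit_moore hσ hu
  have hMdet : IsUnit (moore σ u).det := (Matrix.isUnit_iff_isUnit_det _).mp hM
  let g : Fin (k + 1 + r) → K := Fin.append u (fun l => ∑ j, u j * X j l)
  have hgen : gabGenerator σ (k + 1) g = moore σ u * standardForm X := by
    funext i
    rw [Matrix.mul_apply_eq_vecMul, vecMul_standardForm]
    funext j
    refine Fin.addCases (fun j => ?_) (fun l => ?_) j
    · simp [gabGenerator, g, moore]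
    · simp only [gabGenerator, g, moore, Matrix.vecMul, dotProduct, Matrix.of_apply,
        Fin.append_right]
      exact hrow i (Nat.le_of_lt_succ i.2) l
  refine ⟨g, ?_, ?_⟩
  · rw [Fintype.linearIndependent_iff]
    intro c hc
    -- The images of the relation `c` under all `σ ^ i` say that the invertible Moore matrix of `u`
    -- kills this vector.
    have hy : (fun j => algebraMap F K (c (Fin.castAdd r j)) +
        ∑ l, X j l * algebraMap F K (c (Fin.natAdd (k + 1) l))) = 0 := by
      apply Matrix.mulVec_injective_of_isUnit hM
      funext i
      have := congrArg (σ ^ (i : ℕ)) hc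
      rw [Matrix.mulVec_zero, Pi.zero_apply, ← map_zero (σ ^ (i : ℕ)), ← this, Fin.sum_univ_add,
        map_add, map_sum, map_sum]
      simp only [g, Fin.append_left, Fin.append_right, Algebra.smul_def, map_mul,
        AlgEquiv.commutes, hrow i (Nat.le_of_lt_succ i.2)]
      simp only [Matrix.mulVec, dotProduct, moore,
        Matrix.of_apply, mul_add, Finset.sum_add_distrib, Finset.mul_sum]
      congr 1
      · exact Finset.sum_congr rfl fun j _ => mul_comm _ _
      · rw [Finset.sum_comm]
        exact Finset.sum_congr rfl fun l _ => Finset.sum_congr rfl fun i _ => by ring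
    -- On row `0` of `hy`, `σ - 1` removes the term in `F` and leaves `a 0` times a relation among
    -- the entries of `b`.
    have hd : ∀ l, c (Fin.natAdd (k + 1) l) = 0 := by
      apply Fintype.linearIndependent_iff.mp hb
      have h1 : algebraMap F K (c (Fin.castAdd r 0)) +
        ∑ l, X 0 l * algebraMap F K (c (Fin.natAdd (k + 1) l)) = 0 := congrFun hy 0
      have h2 := congrArg σ h1
      rw [map_zero, ← h1, map_add, AlgEquiv.commutes, add_right_inj, map_sum, ← sub_eq_zero, ← Finset.sum_sub_distrib] at h2
      apply (mul_right_injective₀ (ha.ne_zero 0))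
      simp only [mul_zero, Finset.mul_sum]
      rw [← h2]
      refine Finset.sum_congr rfl fun l _ => ?_
      rw [map_mul, AlgEquiv.commutes, ← sub_mul, hab, Algebra.smul_def]
      ring
    have hc' : ∀ j, c (Fin.castAdd r j) = 0 := fun j => by
      simpa [hd] using congrFun hy j
    exact fun j => Fin.addCases hc' hd j
  · ext z
    rw [hgen, codeOf, mem_rowSpace_iff, mem_rowSpace_iff]
    constructor
    · rintro ⟨w, rfl⟩
      exact ⟨w ᵥ* (moore σ u)⁻¹, by
        rw [Matrix.vecMul_vecMul, ← Matrix.mul_assoc, Matrix.nonsing_inv_mul _ hMdet,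
          Matrix.one_mul]⟩
    · rintro ⟨w, rfl⟩
      exact ⟨w ᵥ* moore σ u, by rw [Matrix.vecMul_vecMul]⟩

/-- Row `0` is `a 0` times `b` and column `0` is `b 0` times `a`; nonzero scaling preserves
independence. -/
theorem exists_independent_factors_iff {k r : ℕ} (hk : 0 < k) (hr : 0 < r) (M : Matrix (Fin k) (Fin r) K) :
    (∃ (a : Fin k → K) (b : Fin r → K), LinearIndependent F a ∧ LinearIndependent F b ∧
        ∀ i j, M i j = a i * b j) ↔
      LinearIndependent F (fun j => M ⟨0, hk⟩ j) ∧ LinearIndependent F (fun i => M i ⟨0, hr⟩) ∧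
        ∃ (a : Fin k → K) (b : Fin r → K), ∀ i j, M i j = a i * b j := by
  constructor
  · rintro ⟨a, b, ha, hb, hab⟩
    refine ⟨?_, ?_, a, b, hab⟩
    · simpa only [hab, linearIndependent_mul_left_iff (ha.ne_zero _)] using hb
    · simpa only [hab, mul_comm _ (b _), linearIndependent_mul_left_iff (hb.ne_zero _)] using ha
  · rintro ⟨hrow, hcol, a, b, hab⟩
    have h0 := hrow.ne_zero ⟨0, hr⟩
    simp only [hab, mul_ne_zero_iff] at h0
    simp only [hab, linearIndependent_mul_left_iff h0.1] at hrow
    simp only [hab, mul_comm _ (b _), linearIndependent_mul_left_iff h0.2] at hcol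
    exact ⟨a, b, hcol, hrow, hab⟩

end Criterion

/-! ### Rank one and outer products. -/

section RankOne

variable {K : Type*} [Field K]

theorem exists_factors_of_rank_eq_one {k r : ℕ} {M : Matrix (Fin k) (Fin r) K} (h : M.rank = 1) :
    ∃ (a : Fin k → K) (b : Fin r → K), ∀ i j, M i j = a i * b j := by
  rw [Matrix.rank_eq_finrank_span_row, finrank_eq_one_iff'] at h
  obtain ⟨v, -, hv⟩ := h
  choose a ha using fun i => hv ⟨M.row i, Submodule.subset_span ⟨i, rfl⟩⟩
  exact ⟨a, v, fun i j => (congrFun (congrArg Subtype.val (ha i)) j).symm⟩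

theorem rank_eq_one_of_factors {k r : ℕ} {M : Matrix (Fin k) (Fin r) K} {a : Fin k → K}
    {b : Fin r → K} (h : ∀ i j, M i j = a i * b j) {i : Fin k} {j : Fin r} (hij : M i j ≠ 0) :
    M.rank = 1 := by
  apply le_antisymm
  · rw [show M = Matrix.vecMulVec a b from Matrix.ext h]
    exact Matrix.rank_vecMulVec_le a b
  · rw [Nat.one_le_iff_ne_zero]
    intro h0
    rw [Matrix.rank, Submodule.finrank_eq_zero, LinearMap.range_eq_bot] at h0
    apply hij
    have := congrFun (LinearMap.congr_fun h0 (Pi.single j 1)) i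
    simpa using this

end RankOne

/-! ### The criteria for `θ^s`, and echelon forms of Gabidulin codes. -/

section Codes

variable {F K : Type*} [Field F] [Fintype F] [Field K] [Finite K] [Algebra F K]

/-- By Bézout, the Frobenius, of order `m`, is a power of `θ^s`; so a fixed point of `θ^s` is fixed
by the whole Galois group. -/
theorem fixesOnlyBase_theta {s : ℤ} (hs : IsCoprime s (Module.finrank F K : ℤ)) :
    FixesOnlyBase (theta F K s) := by
  intro x hx
  let φ := FiniteField.frobeniusAlgEquivOfAlgebraic F K
  have hφ : φ ∈ MulAction.stabilizer Gal(K/F) x := by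
    obtain ⟨a, b, hab⟩ := hs
    have h1 : φ ^ s ∈ MulAction.stabilizer Gal(K/F) x := hx
    have h2 : φ ^ (Module.finrank F K) = 1 := by
      rw [← FiniteField.orderOf_frobeniusAlgEquivOfAlgebraic, pow_orderOf_eq_one]
    rw [← zpow_one φ, ← hab, zpow_add, mul_comm a, mul_comm b, zpow_mul, zpow_mul φ,
      zpow_natCast, h2, one_zpow, mul_one]
    exact Subgroup.zpow_mem _ h1 a
  refine IntermediateField.mem_bot.mp ((IsGalois.mem_bot_iff_fixed x).mpr fun f => ?_)
  obtain ⟨n, rfl⟩ := (FiniteField.bijective_frobeniusAlgEquivOfAlgebraic_pow F K).2 f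
  exact Subgroup.pow_mem _ hφ n

theorem coe_rowSpace_gabGenerator (k : ℕ) {n : ℕ} (s : ℤ) (g : Fin n → K) :
    (rowSpace (gabGenerator (theta F K s) k g) : Set (Fin n → K)) = gabCode F k s g := by
  have hpow : ∀ i : ℕ, theta F K (s * i) = theta F K s ^ i := fun i => by
    rw [theta, theta, zpow_mul, zpow_natCast]
  ext z
  simp only [SetLike.mem_coe, mem_rowSpace_iff, gabCode, linPoly, Set.mem_ofPred_eq,
    hpow]
  constructor
  · rintro ⟨c, rfl⟩
    exact ⟨_, ⟨c, rfl⟩, rfl⟩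
  · rintro ⟨_, ⟨c, rfl⟩, rfl⟩
    exact ⟨c, rfl⟩

theorem mem_Gab_iff {k n : ℕ} {s : ℤ} {U : Submodule K (Fin n → K)} :
    U ∈ Gab F K k n s ↔ Module.finrank K U = k ∧ ∃ g : Fin n → K, LinearIndependent F g ∧
      U = rowSpace (gabGenerator (theta F K s) k g) := by
  simp only [Gab, Set.mem_ofPred_eq, ← coe_rowSpace_gabGenerator, SetLike.coe_set_eq,
    qRank_eq_iff_linearIndependent]

variable {k r : ℕ} {s : ℤ}

theorem codeOf_mem_Gab_iff_exists_factors (hk : 0 < k) (hr : 0 < r)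
    (hs : IsCoprime s (Module.finrank F K : ℤ)) (X : Matrix (Fin k) (Fin r) K) :
    codeOf X ∈ Gab F K k (k + r) s ↔
      ∃ (a : Fin k → K) (b : Fin r → K), LinearIndependent F a ∧ LinearIndependent F b ∧
        ∀ i j, Phi F s X i j = a i * b j := by
  rw [mem_Gab_iff]
  constructor
  · rintro ⟨-, g, hg, hX⟩
    exact exists_factors_of_codeOf_eq (fixesOnlyBase_theta hs) hk hr hg hX
  · rintro ⟨a, b, ha, hb, hab⟩
    exact ⟨finrank_codeOf X, exists_codeOf_eq_of_factors (fixesOnlyBase_theta hs) hk ha hb hab⟩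

theorem criterion_one (hk : 0 < k) (hr : 0 < r) (hs : IsCoprime s (Module.finrank F K : ℤ))
    (X : Matrix (Fin k) (Fin r) K) :
    codeOf X ∈ Gab F K k (k + r) s ↔
      LinearIndependent F (fun j => Phi F s X ⟨0, hk⟩ j) ∧
      LinearIndependent F (fun i => Phi F s X i ⟨0, hr⟩) ∧ (Phi F s X).rank = 1 := by
  rw [codeOf_mem_Gab_iff_exists_factors hk hr hs, exists_independent_factors_iff hk hr]
  refine and_congr_right fun hrow => and_congr_right fun _ => ⟨?_, exists_factors_of_rank_eq_one⟩
  rintro ⟨a, b, hab⟩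
  exact rank_eq_one_of_factors hab (hrow.ne_zero ⟨0, hr⟩)

/-- The `2 × 2` minors through the corner entry replace the rank, giving equations a program can
test. Independence makes the corner nonzero. -/
theorem codeOf_mem_Gab_iff_of_equations (hk : 0 < k) (hr : 0 < r)
    (hs : IsCoprime s (Module.finrank F K : ℤ)) (X : Matrix (Fin k) (Fin r) K) :
    codeOf X ∈ Gab F K k (k + r) s ↔
      (∀ i j, Phi F s X i j * Phi F s X ⟨0, hk⟩ ⟨0, hr⟩ =
        Phi F s X i ⟨0, hr⟩ * Phi F s X ⟨0, hk⟩ j) ∧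
      LinearIndependent F (fun j => Phi F s X ⟨0, hk⟩ j) ∧
      LinearIndependent F (fun i => Phi F s X i ⟨0, hr⟩) := by
  rw [codeOf_mem_Gab_iff_exists_factors hk hr hs, exists_independent_factors_iff hk hr]
  constructor
  · rintro ⟨hrow, hcol, a, b, hab⟩
    refine ⟨fun i j => ?_, hrow, hcol⟩
    simp only [hab]
    ring
  · rintro ⟨h, hrow, hcol⟩
    refine ⟨hrow, hcol, fun i => Phi F s X i ⟨0, hr⟩ / Phi F s X ⟨0, hk⟩ ⟨0, hr⟩,
      Phi F s X ⟨0, hk⟩, fun i j => ?_⟩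
    rw [div_mul_eq_mul_div, ← h, mul_div_cancel_right₀ _ (hrow.ne_zero ⟨0, hr⟩)]

/-- A matrix in reduced row echelon form that generates a Gabidulin code is in standard form. -/
theorem eq_standardForm_of_isReducedRowEchelon (hs : IsCoprime s (Module.finrank F K : ℤ))
    {R : Matrix (Fin k) (Fin (k + r)) K} (hR : R.IsReducedRowEchelon)
    (h : rowSpace R ∈ Gab F K k (k + r) s) (i j : Fin k) :
    R i (Fin.castAdd r j) = (1 : Matrix (Fin k) (Fin k) K) i j := by
  obtain ⟨-, g, hg, hU⟩ := mem_Gab_iff.mp h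
  let L : Matrix (Fin k) (Fin k) K := Matrix.of fun i j => R i (Fin.castAdd r j)
  have hM := isUnit_moore (fixesOnlyBase_theta hs) (hg.comp _ (Fin.castAdd_injective k r))
  -- The Moore matrix of the first `k` entries of `g` is invertible, so the code projects onto the
  -- first `k` coordinates.
  have hL : IsUnit L := by
    rw [← Matrix.vecMul_surjective_iff_isUnit]
    intro w
    obtain ⟨f, rfl⟩ := Matrix.vecMul_surjective_iff_isUnit.mpr hM w
    obtain ⟨c, hc⟩ : ∃ c, c ᵥ* R = f ᵥ* gabGenerator (theta F K s) k g := by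
      rw [← mem_rowSpace_iff, hU, mem_rowSpace_iff]
      exact ⟨f, rfl⟩
    exact ⟨c, funext fun j => congrFun hc (Fin.castAdd r j)⟩
  have htri : ∀ n, ∀ i : Fin k, (i : ℕ) = n → ∀ j : Fin (k + r), (j : ℕ) < i → R i j = 0 := by
    intro n
    induction n with
    | zero => intro i hi j hj; omega
    | succ n ih =>
      intro i hi j hj
      refine hR.isRowEchelon (i₁ := ⟨n, by omega⟩) (Fin.lt_def.mpr (by simp [hi])) fun j₁ hj₁ => ?_
      have := Fin.lt_def.mp hj₁
      exact ih _ rfl _ (by simp only; omega)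
  have hup : L.IsUpperTriangular := fun i j hij => htri _ i rfl (Fin.castAdd r j) hij
  have hdiag : ∀ i, L i i ≠ 0 := by
    have hdet := ((Matrix.isUnit_iff_isUnit_det _).mp hL).ne_zero
    rw [Matrix.det_of_isUpperTriangular hup,
      Finset.prod_ne_zero_iff] at hdet
    exact fun i => hdet i (Finset.mem_univ i)
  have hlead : ∀ i, R.IsLeadingEntry i (Fin.castAdd r i) := fun i =>
    ⟨fun j hj => htri _ i rfl j (Fin.lt_def.mp hj), hdiag i⟩
  by_cases hij : i = j
  · subst hij
    rw [Matrix.one_apply_eq]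
    exact hR.eq_one (hlead i)
  · rw [Matrix.one_apply_ne hij]
    exact hR.eq_zero_of_ne_of_isLeadingEntry hij (hlead j)

theorem rowSpace_mem_Gab_iff
    (hs : IsCoprime s (Module.finrank F K : ℤ)) {R : Matrix (Fin k) (Fin (k + r)) K}
    (hR : R.IsReducedRowEchelon) :
    rowSpace R ∈ Gab F K k (k + r) s ↔
      (∀ i j, R i (Fin.castAdd r j) = (1 : Matrix (Fin k) (Fin k) K) i j) ∧
        codeOf (Matrix.of fun i j => R i (Fin.natAdd k j)) ∈ Gab F K k (k + r) s := by
  have hstd : (∀ i j, R i (Fin.castAdd r j) = (1 : Matrix (Fin k) (Fin k) K) i j) →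
      standardForm (Matrix.of fun i j => R i (Fin.natAdd k j)) = R := by
    intro h
    funext i j
    refine Fin.addCases (fun j => ?_) (fun j => ?_) j
    · simp [standardForm, h]
    · simp [standardForm]
  constructor
  · intro h
    have h1 := eq_standardForm_of_isReducedRowEchelon hs hR h
    refine ⟨h1, ?_⟩
    rw [← hstd h1] at h
    exact h
  · rintro ⟨h1, h2⟩
    exact congrArg rowSpace (hstd h1) ▸ h2

end Codes

/-! ### Composition, cost and powers in programs. -/

section Programs

variable {K ρ β γ : Type*}

/-- Run `P`, then continue with the program selected by its result. -/
def Prog.bind : Prog K ρ β → (β → Prog K ρ γ) → Prog K ρ γ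
  | .halt b, f => f b
  | .const d c next, f => .const d c (next.bind f)
  | .op d o a b next, f => .op d o a b (next.bind f)
  | .ifZero a yes no, f => .ifZero a (yes.bind f) (no.bind f)

variable [Field K] [DecidableEq ρ]

theorem Prog.run_bind (P : Prog K ρ β) (f : β → Prog K ρ γ) (v : ρ → K) :
    (P.bind f).run v = (f (P.run v).2).run (P.run v).1 := by
  induction P generalizing v with
  | halt b => rfl
  | const d c next ih => exact ih _
  | op d o a b next ih => exact ih _
  | ifZero a yes no ih₁ ih₂ =>
    simp only [Prog.bind, Prog.run]
    split_ifs
    exacts [ih₁ _, ih₂ _]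

theorem Prog.cost_bind (P : Prog K ρ β) (f : β → Prog K ρ γ) (v : ρ → K) :
    (P.bind f).cost v = P.cost v + (f (P.run v).2).cost (P.run v).1 := by
  induction P generalizing v with
  | halt b => simp [Prog.bind, Prog.cost, Prog.run]
  | const d c next ih => simp only [Prog.bind, Prog.cost, Prog.run, ih]; omega
  | op d o a b next ih => simp only [Prog.bind, Prog.cost, Prog.run, ih]; omega
  | ifZero a yes no ih₁ ih₂ =>
    simp only [Prog.bind, Prog.cost, Prog.run]
    split_ifs
    · rw [ih₁]; omega
    · rw [ih₂]; omega

/-- A program changes at most as many registers as it executes steps. -/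
theorem Prog.card_le_cost (P : Prog K ρ β) (v : ρ → K) (S : Finset ρ)
    (hS : ∀ x ∈ S, (P.run v).1 x ≠ v x) : S.card ≤ P.cost v := by
  induction P generalizing v S with
  | halt b =>
    rw [Finset.card_eq_zero.mpr (Finset.eq_empty_of_forall_notMem fun x hx => hS x hx rfl)]
    exact Nat.zero_le _
  | const d c next ih =>
    have h₁ := Finset.pred_card_le_card_erase (s := S) (a := d)
    have h₂ := ih (Function.update v d c) (S.erase d) fun x hx => by
      rw [Finset.mem_erase] at hx
      rw [Function.update_of_ne hx.1]
      exact hS x hx.2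
    simp only [Prog.cost]
    omega
  | op d o a b next ih =>
    have h₁ := Finset.pred_card_le_card_erase (s := S) (a := d)
    have h₂ := ih (Function.update v d (o.eval (v a) (v b))) (S.erase d) fun x hx => by
      rw [Finset.mem_erase] at hx
      rw [Function.update_of_ne hx.1]
      exact hS x hx.2
    simp only [Prog.cost]
    omega
  | ifZero a yes no ih₁ ih₂ =>
    simp only [Prog.run] at hS
    simp only [Prog.cost]
    split_ifs at hS ⊢
    · exact (ih₁ v S hS).trans (Nat.le_succ _)
    · exact (ih₂ v S hS).trans (Nat.le_succ _)

/-- Some program transforms the register contents by `f` in at most `T` steps. -/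
def Realizes (T : ℕ) (f : (ρ → K) → ρ → K) : Prop :=
  ∃ P : Prog K ρ Unit, ∀ v, (P.run v).1 = f v ∧ P.cost v ≤ T

theorem Realizes.mono {T T' : ℕ} {f : (ρ → K) → ρ → K} (h : Realizes T f) (hT : T ≤ T') :
    Realizes T' f := by
  obtain ⟨P, hP⟩ := h
  exact ⟨P, fun v => ⟨(hP v).1, (hP v).2.trans hT⟩⟩

theorem Realizes.comp {T T' : ℕ} {f g : (ρ → K) → ρ → K} (hf : Realizes T f)
    (hg : Realizes T' g) : Realizes (T + T') (fun v => g (f v)) := by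
  obtain ⟨P, hP⟩ := hf
  obtain ⟨Q, hQ⟩ := hg
  refine ⟨P.bind fun _ => Q, fun v => ?_⟩
  rw [Prog.run_bind, Prog.cost_bind, (hP v).1]
  exact ⟨(hQ _).1, add_le_add (hP v).2 (hQ _).2⟩

theorem realizes_id : Realizes 0 (fun v : ρ → K => v) :=
  ⟨.halt (), fun _ => ⟨rfl, le_rfl⟩⟩

theorem realizes_const (d : ρ) (c : K) : Realizes 1 (fun v => Function.update v d c) :=
  ⟨.const d c (.halt ()), fun _ => ⟨rfl, le_rfl⟩⟩

theorem realizes_op (d : ρ) (o : FieldOp) (a b : ρ) :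
    Realizes 1 (fun v : ρ → K => Function.update v d (o.eval (v a) (v b))) :=
  ⟨.op d o a b (.halt ()), fun _ => ⟨rfl, le_rfl⟩⟩

theorem realizes_copy {a d : ρ} (had : a ≠ d) :
    Realizes 2 (fun v : ρ → K => Function.update v d (v a)) := by
  convert (realizes_const (K := K) d 0).comp (realizes_op d .add a d) using 2 with v
  simp [FieldOp.eval, Function.update_of_ne had]

/-- Repeated squaring; each binary digit after the first costs at most two multiplications. -/
theorem realizes_pow {a d : ρ} (had : a ≠ d) {n : ℕ} (hn : 0 < n) :
    Realizes (2 * Nat.log 2 n + 2) (fun v : ρ → K => Function.update v d (v a ^ n)) := by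
  induction n using Nat.strong_induction_on with
  | _ n ih =>
    rcases Nat.lt_or_ge n 2 with h2 | h2
    · obtain rfl : n = 1 := by omega
      simpa using realizes_copy (K := K) had
    have hlog : Nat.log 2 n = Nat.log 2 (n / 2) + 1 := Nat.log_of_one_lt_of_le one_lt_two h2
    have hsq := (ih (n / 2) (by omega) (by omega)).comp (realizes_op d .mul d d)
    rcases Nat.mod_two_eq_zero_or_one n with h0 | h0
    · refine Realizes.mono (T := 2 * Nat.log 2 (n / 2) + 2 + 1) ?_ (by omega)
      convert hsq using 2 with v
      simp only [FieldOp.eval, Function.update_self, Function.update_idem]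
      rw [← pow_add]
      congr 2
      omega
    · refine Realizes.mono (T := 2 * Nat.log 2 (n / 2) + 2 + 1 + 1) ?_ (by omega)
      convert hsq.comp (realizes_op d .mul d a) using 2 with v
      simp only [FieldOp.eval, Function.update_self, Function.update_idem,
        Function.update_of_ne had]
      rw [← pow_add, ← pow_succ]
      congr 2
      omega

/-- `realizes_pow` cannot overwrite its source, so each `q`-th power is formed in `t` and copied
back to `d`. -/
theorem realizes_iterate_pow {a d t : ρ} (had : a ≠ d) (hdt : d ≠ t) {q : ℕ} (hq : 0 < q)
    (e : ℕ) : ∃ f : (ρ → K) → ρ → K, Realizes (2 + e * (2 * Nat.log 2 q + 4)) f ∧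
      ∀ v, f v d = v a ^ q ^ e ∧ ∀ x, x ≠ d → x ≠ t → f v x = v x := by
  induction e with
  | zero =>
    exact ⟨_, by simpa using realizes_copy had, fun v =>
      ⟨by simp, fun x hx _ => Function.update_of_ne hx _ _⟩⟩
  | succ e ih =>
    obtain ⟨f, hf, hv⟩ := ih
    refine ⟨_, ((hf.comp (realizes_pow hdt hq)).comp (realizes_copy hdt.symm)).mono
      (by rw [Nat.succ_mul e]; omega), fun v => ⟨?_, fun x hx hx' => ?_⟩⟩
    · simp [(hv v).1, pow_succ, pow_mul]
    · simp [hx, hx', (hv v).2 x hx hx']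

end Programs

/-! ### Computations and tests up to the contents of scratch registers. -/

section Scratch

variable {K α : Type*} [DecidableEq α]

/-- The contents of the registers that are not scratch registers. -/
def visible (v : α ⊕ ℕ → K) : α → K := fun x => v (Sum.inl x)

theorem visible_update_inl (v : α ⊕ ℕ → K) (x : α) (c : K) :
    visible (Function.update v (Sum.inl x) c) = Function.update (visible v) x c := by
  funext y
  by_cases h : y = x
  · subst h; simp [visible]
  · simp [visible, h]

theorem visible_update_inr (v : α ⊕ ℕ → K) (i : ℕ) (c : K) :
    visible (Function.update v (Sum.inr i) c) = visible v := by
  funext y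
  simp [visible]

variable [Field K]

/-- Some program transforms the contents of the visible registers by `f` in at most `T` steps;
what it leaves in the scratch registers is unspecified. -/
def Transforms (T : ℕ) (f : (α → K) → α → K) : Prop :=
  ∃ g : (α ⊕ ℕ → K) → α ⊕ ℕ → K, Realizes T g ∧ ∀ v, visible (g v) = f (visible v)

/-- Some program computes `e` from the contents of the visible registers, without changing them,
in at most `T` steps. -/
def Evaluates (T : ℕ) (e : (α → K) → K) : Prop :=
  ∃ g : (α ⊕ ℕ → K) → α ⊕ ℕ → K, Realizes T g ∧
    ∀ v, visible (g v) = visible v ∧ g v (Sum.inr 0) = e (visible v)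

/-- Some program decides the property `p` of the contents of the visible registers in at most `T`
steps. -/
def Tests (T : ℕ) (p : (α → K) → Prop) : Prop :=
  ∃ P : Prog K (α ⊕ ℕ) Bool, ∀ v, ((P.run v).2 = true ↔ p (visible v)) ∧ P.cost v ≤ T

theorem Transforms.mono {T T' : ℕ} {f : (α → K) → α → K} (h : Transforms T f) (hT : T ≤ T') :
    Transforms T' f := by
  obtain ⟨g, hg, hv⟩ := h
  exact ⟨g, hg.mono hT, hv⟩

theorem Transforms.comp {T T' : ℕ} {f g : (α → K) → α → K} (hf : Transforms T f)
    (hg : Transforms T' g) : Transforms (T + T') (fun v => g (f v)) := by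
  obtain ⟨f', hf', hf⟩ := hf
  obtain ⟨g', hg', hg⟩ := hg
  exact ⟨_, hf'.comp hg', fun v => by rw [hg, hf]⟩

theorem transforms_id : Transforms 0 (fun v : α → K => v) :=
  ⟨_, realizes_id, fun _ => rfl⟩

theorem transforms_const (x : α) (c : K) : Transforms 1 (fun v => Function.update v x c) :=
  ⟨_, realizes_const (Sum.inl x) c, fun v => visible_update_inl v x c⟩

theorem transforms_op (x : α) (o : FieldOp) (a b : α) :
    Transforms 1 (fun v : α → K => Function.update v x (o.eval (v a) (v b))) :=
  ⟨_, realizes_op (Sum.inl x) o (Sum.inl a) (Sum.inl b), fun v => visible_update_inl v x _⟩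

theorem transforms_pow_sub (x : α) {q : ℕ} (hq : 0 < q) (e : ℕ) :
    Transforms (3 + e * (2 * Nat.log 2 q + 4))
      (fun v : α → K => Function.update v x (v x ^ q ^ e - v x)) := by
  obtain ⟨f, hf, hv⟩ := realizes_iterate_pow (K := K) (a := (Sum.inl x : α ⊕ ℕ)) (d := Sum.inr 0)
    (t := Sum.inr 1) (by simp) (by simp) hq e
  refine ⟨_, (hf.comp (realizes_op (Sum.inl x) .sub (Sum.inr 0) (Sum.inl x))).mono (by omega),
    fun v => ?_⟩
  rw [visible_update_inl, FieldOp.eval, (hv v).1, (hv v).2 _ (by simp) (by simp),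
    show visible (f v) = visible v from funext fun y => (hv v).2 _ (by simp) (by simp)]
  rfl

/-- Changing the registers of `S` one by one. -/
theorem transforms_finset {T : ℕ} (S : Finset α) (h : (α → K) → α → K)
    (hT : ∀ x ∈ S, Transforms T (fun v => Function.update v x (h v x)))
    (hh : ∀ x ∈ S, ∀ v v', (∀ y, y ∉ S ∨ y = x → v y = v' y) → h v x = h v' x) :
    Transforms (S.card * T) (fun v x => if x ∈ S then h v x else v x) := by
  induction S using Finset.induction_on with
  | empty => simpa using transforms_id (K := K) (α := α)
  | insert a S ha ih =>
    have := (hT a (Finset.mem_insert_self a S)).comp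
      (ih (fun x hx => hT x (Finset.mem_insert_of_mem hx))
        (fun x hx v v' hv => hh x (Finset.mem_insert_of_mem hx) v v' fun y hy =>
          hv y (hy.imp_left fun h hy' => h (Finset.mem_insert_of_mem hy'))))
    rw [Finset.card_insert_of_notMem ha, Nat.succ_mul, add_comm]
    convert this using 3 with v x
    by_cases hx : x ∈ S
    · have hxa : x ≠ a := fun h => ha (h ▸ hx)
      rw [if_pos (Finset.mem_insert_of_mem hx), if_pos hx]
      -- The new value at `x` ignores the other registers of the set, so the earlier update of `a`
      -- does not affect it.
      refine hh x (Finset.mem_insert_of_mem hx) _ _ fun y hy => ?_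
      rw [Function.update_of_ne]
      rintro rfl
      rcases hy with hy | hy
      · exact hy (Finset.mem_insert_self _ _)
      · exact hxa hy.symm
    · by_cases hxa : x = a
      · subst hxa; simp [hx]
      · simp [hx, hxa]

theorem evaluates_sub_const (x : α) (c : K) : Evaluates 2 (fun v => v x - c) :=
  ⟨_, (realizes_const (Sum.inr 0) c).comp (realizes_op (Sum.inr 0) .sub (Sum.inl x) (Sum.inr 0)),
    fun v => by simp [visible_update_inr, FieldOp.eval, visible]⟩

theorem evaluates_mul_sub_mul (a b c d : α) :
    Evaluates 3 (fun v : α → K => v a * v b - v c * v d) :=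
  ⟨_, ((realizes_op (Sum.inr 0) .mul (Sum.inl a) (Sum.inl b)).comp
    (realizes_op (Sum.inr 1) .mul (Sum.inl c) (Sum.inl d))).comp
    (realizes_op (Sum.inr 0) .sub (Sum.inr 0) (Sum.inr 1)),
    fun v => by simp [visible_update_inr, FieldOp.eval, visible]⟩

theorem Tests.mono {T T' : ℕ} {p : (α → K) → Prop} (h : Tests T p) (hT : T ≤ T') : Tests T' p := by
  obtain ⟨P, hP⟩ := h
  exact ⟨P, fun v => ⟨(hP v).1, (hP v).2.trans hT⟩⟩

theorem tests_true : Tests 0 (fun _ : α → K => True) :=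
  ⟨.halt true, fun _ => ⟨by simp [Prog.run], le_rfl⟩⟩

theorem Transforms.tests {T T' : ℕ} {f : (α → K) → α → K} {p : (α → K) → Prop}
    (hf : Transforms T f) (hp : Tests T' p) : Tests (T + T') (fun v => p (f v)) := by
  obtain ⟨g, ⟨P, hP⟩, hg⟩ := hf
  obtain ⟨Q, hQ⟩ := hp
  refine ⟨P.bind fun _ => Q, fun v => ?_⟩
  rw [Prog.run_bind, Prog.cost_bind, (hP v).1]
  simp only [← hg]
  exact ⟨(hQ _).1, add_le_add (hP v).2 (hQ _).2⟩

open Classical in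
theorem Evaluates.tests_ite {T T₁ : ℕ} {e : (α → K) → K} {p q : (α → K) → Prop}
    (he : Evaluates T e) (hp : Tests T₁ p) (hq : Tests T₁ q) :
    Tests (T + 1 + T₁) (fun v => if e v = 0 then p v else q v) := by
  obtain ⟨g, ⟨P, hP⟩, hg⟩ := he
  obtain ⟨Q₁, hQ₁⟩ := hp
  obtain ⟨Q₂, hQ₂⟩ := hq
  refine ⟨P.bind fun _ => .ifZero (Sum.inr 0) Q₁ Q₂, fun v => ?_⟩
  have hc := (hP v).2
  have h₁ := hQ₁ (g v)
  have h₂ := hQ₂ (g v)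
  rw [(hg v).1] at h₁ h₂
  rw [Prog.run_bind, Prog.cost_bind, (hP v).1]
  simp only [Prog.run, Prog.cost, (hg v).2]
  split_ifs
  · exact ⟨h₁.1, by omega⟩
  · exact ⟨h₂.1, by omega⟩

theorem tests_false (T : ℕ) : Tests T (fun _ : α → K => False) :=
  ⟨.halt false, fun _ => ⟨by simp [Prog.run], Nat.zero_le _⟩⟩

theorem Evaluates.tests_eq_zero_and {T T₁ : ℕ} {e : (α → K) → K} {p : (α → K) → Prop}
    (he : Evaluates T e) (hp : Tests T₁ p) : Tests (T + 1 + T₁) (fun v => e v = 0 ∧ p v) := by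
  convert he.tests_ite hp (tests_false T₁) using 2 with v
  split_ifs with h <;> simp [h]

theorem Evaluates.tests_ne_zero_and {T T₁ : ℕ} {e : (α → K) → K} {p : (α → K) → Prop}
    (he : Evaluates T e) (hp : Tests T₁ p) : Tests (T + 1 + T₁) (fun v => e v ≠ 0 ∧ p v) := by
  convert he.tests_ite (tests_false T₁) hp using 2 with v
  split_ifs with h <;> simp [h]

theorem tests_finset_eq_zero_and {ι : Type*} {T T₁ : ℕ} (S : Finset ι) {e : ι → (α → K) → K}
    {p : (α → K) → Prop} (he : ∀ i ∈ S, Evaluates T (e i)) (hp : Tests T₁ p) :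
    Tests (S.card * (T + 1) + T₁) (fun v => (∀ i ∈ S, e i v = 0) ∧ p v) := by
  classical
  induction S using Finset.induction_on with
  | empty => simpa using hp
  | insert a S ha ih =>
    have := (he a (Finset.mem_insert_self a S)).tests_eq_zero_and
      (ih fun i hi => he i (Finset.mem_insert_of_mem hi))
    rw [Finset.card_insert_of_notMem ha, Nat.succ_mul, add_comm (S.card * (T + 1)), add_assoc]
    simpa only [Finset.forall_mem_insert, and_assoc] using this

open Classical in
theorem Evaluates.transforms_ite {T T₁ T₂ : ℕ} {e : (α → K) → K} {f g : (α → K) → α → K}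
    (he : Evaluates T e) (hf : Transforms T₁ f) (hg : Transforms T₂ g) :
    Transforms (T + 1 + (T₁ + T₂)) (fun v => if e v = 0 then f v else g v) := by
  obtain ⟨h, ⟨P, hP⟩, hh⟩ := he
  obtain ⟨f', ⟨Q₁, hQ₁⟩, hf'⟩ := hf
  obtain ⟨g', ⟨Q₂, hQ₂⟩, hg'⟩ := hg
  refine ⟨fun v => if e (visible v) = 0 then f' (h v) else g' (h v),
    ⟨P.bind fun _ => .ifZero (Sum.inr 0) Q₁ Q₂, fun v => ?_⟩, fun v => ?_⟩
  · have hc := (hP v).2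
    have h₁ := hQ₁ (h v)
    have h₂ := hQ₂ (h v)
    rw [Prog.run_bind, Prog.cost_bind, (hP v).1]
    simp only [Prog.run, Prog.cost, (hh v).2]
    split_ifs
    · exact ⟨h₁.1, by omega⟩
    · exact ⟨h₂.1, by omega⟩
  · dsimp only
    split_ifs
    · rw [hf', (hh v).1]
    · rw [hg', (hh v).1]

open Classical in
theorem transforms_ite_forall_eq {T₁ T₂ : ℕ} {f g : (α → K) → α → K} (S : Finset α) (M : α → K)
    (hf : Transforms T₁ f) (hg : Transforms T₂ g) :
    ∃ T, Transforms T (fun v => if ∀ x ∈ S, v x = M x then f v else g v) := by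
  induction S using Finset.induction_on with
  | empty => exact ⟨T₁, by simpa using hf⟩
  | insert a S ha ih =>
    obtain ⟨T, hT⟩ := ih
    refine ⟨2 + 1 + (T + T₂), ?_⟩
    convert (evaluates_sub_const a (M a)).transforms_ite hT hg using 2 with v
    simp only [Finset.forall_mem_insert, sub_eq_zero, ite_and]

/-- Over a finite field, every function of finitely many registers is computed by a program. -/
theorem exists_transforms [Fintype α] [Finite K] (f : (α → K) → α → K) : ∃ T, Transforms T f := by
  classical
  have := Fintype.ofFinite K
  -- A lookup table, extended by one input at a time.
  suffices h : ∀ S : Finset (α → K), ∃ T, Transforms T (fun v => if v ∈ S then f v else v) by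
    simpa using h Finset.univ
  intro S
  induction S using Finset.induction_on with
  | empty => exact ⟨0, by simpa using transforms_id⟩
  | insert M S hM ih =>
    obtain ⟨T, hT⟩ := ih
    have hconst := transforms_finset Finset.univ (fun _ : α → K => f M)
      (fun x _ => transforms_const x (f M x)) (fun _ _ _ _ _ => rfl)
    obtain ⟨T', hT'⟩ := transforms_ite_forall_eq Finset.univ M hconst hT
    refine ⟨T', ?_⟩
    convert hT' using 2 with v
    by_cases hv : v = M
    · subst hv; simp
    · have : ¬ ∀ x ∈ Finset.univ, v x = M x := fun h => hv (funext fun x => h x (Finset.mem_univ x))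
      rw [if_neg this]
      simp [hv]

end Scratch

/-! ### Existence of reduced echelon forms and a lower bound for their cost. -/

section Echelon

variable {K : Type*} [Field K]

theorem row_mem_rowSpace {k n : ℕ} (G : Matrix (Fin k) (Fin n) K) (i : Fin k) :
    G i ∈ rowSpace G :=
  Submodule.subset_span ⟨i, rfl⟩

theorem exists_isReducedRowEchelon {n : ℕ} (k : ℕ) (U : Submodule K (Fin n → K))
    (hU : Module.finrank K U ≤ k) :
    ∃ R : Matrix (Fin k) (Fin n) K, R.IsReducedRowEchelon ∧ rowSpace R = U := by
  induction k generalizing U with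
  | zero =>
    refine ⟨0, ⟨fun i => i.elim0, fun i => i.elim0, fun i => i.elim0⟩, ?_⟩
    rw [Submodule.finrank_eq_zero.mp (Nat.le_zero.mp hU), rowSpace, Set.range_eq_empty,
      Submodule.span_empty]
  | succ k ih =>
    by_cases hbot : U = ⊥
    · refine ⟨0, ⟨fun _ _ _ _ _ => rfl, fun _ _ h => absurd rfl h.2, fun _ _ _ _ _ => rfl⟩, ?_⟩
      rw [hbot, eq_bot_iff, rowSpace, Submodule.span_le]
      rintro _ ⟨i, rfl⟩
      exact (Submodule.mem_bot K).mpr rfl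
    -- `c` is the first pivot; the remaining rows come from the subspace of `U` vanishing at `c`.
    obtain ⟨c, ⟨w₀, hw₀, hw₀c⟩, hmin⟩ := wellFounded_lt.has_min {c | ∃ u ∈ U, u c ≠ 0} (by
      obtain ⟨u, hu, hu0⟩ := (Submodule.ne_bot_iff U).mp hbot
      obtain ⟨c, hc⟩ := Function.ne_iff.mp hu0
      exact ⟨c, u, hu, hc⟩)
    have hzero : ∀ u ∈ U, ∀ j < c, u j = 0 := fun u hu j hj => by
      by_contra h
      exact hmin j ⟨u, hu, h⟩ hj
    let U' : Submodule K (Fin n → K) := U ⊓ LinearMap.ker (LinearMap.proj c)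
    have hmem : ∀ u, u ∈ U' ↔ u ∈ U ∧ u c = 0 := fun u => by simp [U']
    have hlt : U' < U := by
      refine lt_of_le_of_ne inf_le_left fun h => hw₀c ?_
      exact ((hmem w₀).mp (h ▸ hw₀)).2
    obtain ⟨R, hR, hRU⟩ := ih U'
      (Nat.le_of_lt_succ ((Submodule.finrank_lt_finrank_of_lt hlt).trans_le hU))
    have hrow : ∀ i, R i ∈ U ∧ R i c = 0 := fun i => (hmem _).mp (hRU ▸ row_mem_rowSpace R i)
    let w₁ := (w₀ c)⁻¹ • w₀
    classical
    -- The entries of `w₁` at the pivots of `R`; subtracting `t ᵥ* R` clears them.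
    let t : Fin k → K := fun i => if h : ∃ p, R.IsLeadingEntry i p then w₁ h.choose else 0
    let w := w₁ - t ᵥ* R
    have htR : t ᵥ* R ∈ U' := hRU ▸ mem_rowSpace_iff.mpr ⟨t, rfl⟩
    have hwU : w ∈ U := U.sub_mem (U.smul_mem _ hw₀) ((hmem _).mp htR).1
    have hwc : w c = 1 := by
      simp [w, ((hmem _).mp htR).2, w₁, hw₀c]
    have hwp : ∀ i p, R.IsLeadingEntry i p → w p = 0 := by
      intro i p hp
      have hex : ∃ p, R.IsLeadingEntry i p := ⟨p, hp⟩
      have ht : t i = w₁ p := by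
        simp only [t, dif_pos hex]
        rw [hex.choose_spec.unique hp]
      have : (t ᵥ* R) p = w₁ p := by
        rw [← ht, Matrix.vecMul, dotProduct, Finset.sum_eq_single i, hR.eq_one hp, mul_one]
        · intro l _ hl
          rw [hR.eq_zero_of_ne_of_isLeadingEntry hl hp, mul_zero]
        · simp
      simp [w, this]
    have hwlead : ∀ d, (∀ j < d, w j = 0) → d ≤ c := fun d hd => by
      by_contra h
      exact one_ne_zero (hwc.symm.trans (hd c (not_le.mp h)))
    let R' : Matrix (Fin (k + 1)) (Fin n) K := Fin.cons w R
    refine ⟨R', ⟨?_, ?_, ?_⟩, ?_⟩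
    · intro i₁ i₂ hi j₂ hj
      obtain ⟨i₂, rfl⟩ := Fin.exists_succ_eq.mpr (Fin.ne_zero_of_lt hi)
      change R i₂ j₂ = 0
      rcases Fin.eq_zero_or_eq_succ i₁ with rfl | ⟨i₁, rfl⟩
      · rcases (hwlead j₂ hj).lt_or_eq with h | rfl
        · exact hzero _ (hrow i₂).1 _ h
        · exact (hrow i₂).2
      · exact hR.isRowEchelon (Fin.succ_lt_succ_iff.mp hi) hj
    · intro i d hd
      rcases Fin.eq_zero_or_eq_succ i with rfl | ⟨i, rfl⟩
      · rcases (hwlead d hd.1).lt_or_eq with h | rfl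
        · exact absurd (hzero w hwU d h) hd.2
        · exact hwc
      · exact hR.eq_one (i := i) hd
    · intro i₁ i₂ p hi hp
      obtain ⟨i₂, rfl⟩ := Fin.exists_succ_eq.mpr (Fin.ne_zero_of_lt hi)
      rcases Fin.eq_zero_or_eq_succ i₁ with rfl | ⟨i₁, rfl⟩
      · exact hwp i₂ p hp
      · exact hR.eq_zero (Fin.succ_lt_succ_iff.mp hi) (i₂ := i₂) hp
    · have hspan : rowSpace R' = Submodule.span K {w} ⊔ U' := by
        rw [← hRU, rowSpace, rowSpace, ← Submodule.span_union, Set.singleton_union,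
          ← Fin.range_cons]
      rw [hspan]
      apply le_antisymm
      · exact sup_le ((Submodule.span_singleton_le_iff_mem _ _).mpr hwU) inf_le_left
      · intro u hu
        refine Submodule.mem_sup.mpr ⟨u c • w, Submodule.mem_span_singleton.mpr ⟨_, rfl⟩,
          u - u c • w, (hmem _).mpr ⟨U.sub_mem hu (U.smul_mem _ hwU), ?_⟩, ?_⟩
        · simp [hwc]
        · abel

variable {k n : ℕ}

/-- This makes the set defining `rrefCost` nonempty, so that its infimum is attained. -/
theorem exists_computesRREF [Finite K] : ∃ T, ∃ P : Prog K (Reg k n) Unit,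
    ComputesRREF P ∧ CostAtMost P T := by
  choose R hR hRG using fun G : Matrix (Fin k) (Fin n) K =>
    exists_isReducedRowEchelon k (rowSpace G)
      ((finrank_range_le_card (R := K) fun i => G i).trans_eq (Fintype.card_fin k))
  obtain ⟨T, g, ⟨P, hP⟩, hg⟩ := exists_transforms
    (fun (v : Fin k × Fin n → K) (p : Fin k × Fin n) => R (fun i j => v (i, j)) p.1 p.2)
  have hrun : ∀ M, readMatrix (P.run (load M)).1 = R M := by
    intro M
    rw [(hP _).1]
    funext i j
    exact congrFun (hg (load M)) (i, j)
  refine ⟨T, P, fun M => ?_, fun M => (hP _).2⟩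
  rw [hrun]
  exact ⟨hR M, hRG M⟩

theorem exists_computesRREF_rrefCost [Finite K] : ∃ P : Prog K (Reg k n) Unit,
    ComputesRREF P ∧ CostAtMost P (rrefCost K k n) :=
  Nat.sInf_mem (s := {T | ∃ P : Prog K (Reg k n) Unit, ComputesRREF P ∧ CostAtMost P T})
    exists_computesRREF

/-- On the matrix whose entries all are `a`, with `a ≠ 0, 1`, every register has to be written. -/
theorem mul_le_of_computesRREF {a : K} (ha0 : a ≠ 0) (ha1 : a ≠ 1) {P : Prog K (Reg k n) Unit}
    (hP : ComputesRREF P) {T : ℕ} (hT : CostAtMost P T) : k * n ≤ T := by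
  let M : Matrix (Fin k) (Fin n) K := fun _ _ => a
  refine le_trans ?_ (hT M)
  have hcard : (Finset.univ.map (Function.Embedding.inl : Fin k × Fin n ↪ Reg k n)).card = k * n := by
    simp
  rw [← hcard]
  refine Prog.card_le_cost P _ _ fun x hx hxa => ?_
  obtain ⟨⟨i, j⟩, -, rfl⟩ := Finset.mem_map.mp hx
  obtain ⟨hR, hspan⟩ := hP M
  set R := readMatrix (P.run (load M)).1
  have hij : R i j = a := hxa
  -- All words of the code are constant, so an unchanged entry `a` would make `a ≠ 1` the leading
  -- entry of its row.
  obtain ⟨w, hw⟩ := mem_rowSpace_iff.mp (hspan ▸ row_mem_rowSpace R i)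
  let z : Fin n := ⟨0, j.pos⟩
  have hiz : R i z = a := by
    rw [← hij, ← hw]
    rfl
  have := hR.eq_one (i := i) (c := z)
    ⟨fun l hl => absurd (Fin.lt_def.mp hl) (Nat.not_lt_zero _), hiz ▸ ha0⟩
  exact ha1 (hiz.symm.trans this)

end Echelon

/-! ### Deciding independence over `F`. -/

section Independence

variable {F K α : Type*} [Field F] [Field K] [Algebra F K] [DecidableEq α]

/-- The independence of the contents of `d` registers can be decided by elimination. -/
theorem tests_linearIndependent_and {σ : K ≃ₐ[F] K} (hσ : FixesOnlyBase σ) {q : ℕ} (hq : 2 ≤ q)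
    (hσq : ∀ x, σ x = x ^ q) {T : ℕ} {p : (α → K) → Prop} (hp : Tests T p) {d : ℕ}
    (reg : Fin d → α) (hreg : Function.Injective reg)
    (hpreg : ∀ v v' : α → K, (∀ x, (∀ i : Fin d, (i : ℕ) ≠ 0 → reg i ≠ x) → v x = v' x) →
      (p v ↔ p v')) :
    Tests (11 * Nat.log 2 q * d ^ 2 + T)
      (fun v => LinearIndependent F (fun i => v (reg i)) ∧ p v) := by
  have hL : 0 < Nat.log 2 q := Nat.log_pos one_lt_two hq
  induction d with
  | zero => simpa [linearIndependent_empty_type] using hp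
  | succ d ih =>
    let S : Finset α := Finset.univ.image fun i : Fin d => reg i.succ
    have h0 : ∀ x ∈ S, x ≠ reg 0 := by
      intro x hx
      obtain ⟨i, -, rfl⟩ := Finset.mem_image.mp hx
      exact fun h => Fin.succ_ne_zero i (hreg h)
    have hcard : S.card = d :=
      (Finset.card_image_of_injective _ (hreg.comp (Fin.succ_injective d))).trans (by simp)
    -- One division, one `q`-th power and one subtraction take at most `2 * Nat.log 2 q + 8` steps,
    -- and the logarithm is at least `1`.
    have helim := transforms_finset (T := 10 * Nat.log 2 q) S
      (fun (v : α → K) x => (v x / v (reg 0)) ^ q ^ 1 - v x / v (reg 0))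
      (fun x _ => by
        refine Transforms.mono ?_ (T := 1 + (3 + 1 * (2 * Nat.log 2 q + 4))) (by omega)
        convert (transforms_op x .div x (reg 0)).comp
          (transforms_pow_sub (K := K) x (by omega : 0 < q) 1) using 2 with v
        simp [FieldOp.eval])
      (fun x hx v v' hv => by
        rw [hv x (Or.inr rfl), hv (reg 0) (Or.inl fun h => h0 _ h rfl)])
    have hrec := ih (fun i => reg i.succ) (hreg.comp (Fin.succ_injective d))
      (fun v v' hv => hpreg v v' fun x hx => hv x fun i _ => hx i.succ (by simp))
    have := (evaluates_sub_const (reg 0) (0 : K)).tests_ne_zero_and (helim.tests hrec)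
    refine Tests.mono (T := 2 + 1 + (S.card * (10 * Nat.log 2 q) +
      (11 * Nat.log 2 q * d ^ 2 + T))) ?_ ?_
    · convert this using 2 with v
      rw [linearIndependent_succ_iff hσ, sub_zero, and_assoc]
      -- Elimination overwrites only the registers `reg i` with `i ≠ 0`, to which `p` is
      -- insensitive.
      refine and_congr_right fun _ => and_congr ?_ (hpreg _ _ fun x hx => ?_)
      · simp [S, hσq]
      · rw [if_neg]
        intro hxS
        obtain ⟨i, -, rfl⟩ := Finset.mem_image.mp hxS
        exact hx i.succ (by simp) rfl
    · rw [hcard]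
      nlinarith [Nat.zero_le (Nat.log 2 q * d)]

end Independence

/-! ### The decision procedure and its cost. -/

section Main

variable {F K : Type*} [Field F] [Fintype F] [Field K] [Finite K] [Algebra F K]

variable (F K) in
-- Reducing `s` modulo the order `m` of Frobenius bounds the number of `q`-th powers per entry by
-- `m`.
theorem theta_eq_natCast (s : ℤ) :
    ∃ e < Module.finrank F K, theta F K s = theta F K (e : ℤ) := by
  have hm : (0 : ℤ) < Module.finrank F K := by exact_mod_cast Module.finrank_pos (R := F) (M := K)
  have h0 := Int.emod_nonneg s hm.ne'
  refine ⟨(s % Module.finrank F K).toNat, ?_, ?_⟩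
  · rw [Int.toNat_lt h0]
    exact Int.emod_lt_of_pos _ hm
  · rw [Int.toNat_of_nonneg h0, theta, theta,
      ← FiniteField.orderOf_frobeniusAlgEquivOfAlgebraic F K, zpow_mod_orderOf]

theorem tests_mem_Gab {k r : ℕ} (hk : 0 < k) (hr : 0 < r) {s : ℤ}
    (hs : IsCoprime s (Module.finrank F K : ℤ)) {e : ℕ}
    (he : theta F K s = theta F K (e : ℤ)) :
    Tests (K := K) (α := Fin k × Fin (k + r))
      (k * k * 3 + (k * r * (3 + e * (2 * Nat.log 2 (Fintype.card F) + 4)) + (k * r * 4 +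
        (11 * Nat.log 2 (Fintype.card F) * r ^ 2 + 11 * Nat.log 2 (Fintype.card F) * k ^ 2))))
      (fun v => (∀ i j, v (i, Fin.castAdd r j) = (1 : Matrix (Fin k) (Fin k) K) i j) ∧
        codeOf (Matrix.of fun i j => v (i, Fin.natAdd k j)) ∈ Gab F K k (k + r) s) := by
  have hq : 2 ≤ Fintype.card F := Fintype.one_lt_card
  -- Independence over `F` does not involve `s`, so elimination uses `θ` itself, at one `q`-th power
  -- per entry.
  have hθ : FixesOnlyBase (theta F K 1) := fixesOnlyBase_theta isCoprime_one_left
  have hθq : ∀ x : K, theta F K 1 x = x ^ Fintype.card F := fun x => by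
    simpa using theta_natCast F 1 x
  have hcol := tests_linearIndependent_and hθ hq hθq (tests_true (K := K))
    (fun i : Fin k => ((i, Fin.natAdd k ⟨0, hr⟩) : Fin k × Fin (k + r)))
    (fun i j h => (Prod.ext_iff.mp h).1) (fun _ _ _ => Iff.rfl)
  -- The row test precedes the column test and preserves the corner, the only entry they share.
  have hrow := tests_linearIndependent_and hθ hq hθq hcol
    (fun j : Fin r => (((⟨0, hk⟩ : Fin k), Fin.natAdd k j) : Fin k × Fin (k + r)))
    (fun i j h => Fin.natAdd_injective _ _ (Prod.ext_iff.mp h).2) (fun v v' hv => by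
      have : ∀ i : Fin k, v (i, Fin.natAdd k ⟨0, hr⟩) = v' (i, Fin.natAdd k ⟨0, hr⟩) :=
        fun i => hv _ fun j hj h => hj (by
          have := Fin.natAdd_injective _ _ (Prod.ext_iff.mp h).2
          rw [this])
      simp only [this])
  have heqs := tests_finset_eq_zero_and (Finset.univ : Finset (Fin k × Fin r))
    (fun p _ => evaluates_mul_sub_mul (K := K) ((p.1, Fin.natAdd k p.2) : Fin k × Fin (k + r))
      (⟨0, hk⟩, Fin.natAdd k ⟨0, hr⟩) (p.1, Fin.natAdd k ⟨0, hr⟩) (⟨0, hk⟩, Fin.natAdd k p.2)) hrow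
  let S : Finset (Fin k × Fin (k + r)) :=
    Finset.univ.image fun p : Fin k × Fin r => (p.1, Fin.natAdd k p.2)
  have hinj : Function.Injective fun p : Fin k × Fin r =>
      ((p.1, Fin.natAdd k p.2) : Fin k × Fin (k + r)) := fun p p' h =>
    Prod.ext (Prod.ext_iff.mp h).1 (Fin.natAdd_injective _ _ (Prod.ext_iff.mp h).2)
  have hS : S.card = k * r := (Finset.card_image_of_injective _ hinj).trans (by simp)
  have hPhi := transforms_finset S
    (fun (v : Fin k × Fin (k + r) → K) x => v x ^ Fintype.card F ^ e - v x)
    (fun x _ => transforms_pow_sub x (by omega) e) (fun x _ v v' hv => by rw [hv x (Or.inr rfl)])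
  have hstd := tests_finset_eq_zero_and (Finset.univ : Finset (Fin k × Fin k))
    (fun p _ => evaluates_sub_const ((p.1, Fin.castAdd r p.2) : Fin k × Fin (k + r))
      ((1 : Matrix (Fin k) (Fin k) K) p.1 p.2)) (hPhi.tests heqs)
  rw [hS] at hstd
  simp only [Finset.card_univ, Fintype.card_prod, Fintype.card_fin, add_zero] at hstd
  convert hstd using 2 with v
  refine and_congr (by simp [sub_eq_zero]) ?_
  rw [codeOf_mem_Gab_iff_of_equations hk hr hs]
  have hval : ∀ i j, Phi F s (Matrix.of fun i j => v (i, Fin.natAdd k j)) i j =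
      if ((i, Fin.natAdd k j) : Fin k × Fin (k + r)) ∈ S then
        v (i, Fin.natAdd k j) ^ Fintype.card F ^ e - v (i, Fin.natAdd k j)
      else v (i, Fin.natAdd k j) := by
    intro i j
    rw [if_pos (Finset.mem_image.mpr ⟨(i, j), Finset.mem_univ _, rfl⟩), ← theta_natCast, ← he]
    rfl
  simp only [← hval, sub_eq_zero, Finset.mem_univ, true_implies, Prod.forall, and_true]

theorem exists_decides_Gab {k r : ℕ} (hk : 0 < k) (hr : 0 < r)
    (hkr : k + r ≤ Module.finrank F K) {s : ℤ} (hs : IsCoprime s (Module.finrank F K : ℤ)) :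
    ∃ P : Prog K (Reg k (k + r)) Bool, Decides P (Gab F K k (k + r) s) ∧
      CostAtMost P (40 * Nat.log 2 (Fintype.card F) *
        (Module.finrank F K * rrefCost K k (k + r))) := by
  obtain ⟨e, hem, he⟩ := theta_eq_natCast F K s
  obtain ⟨P, hP, hPT⟩ := exists_computesRREF_rrefCost (K := K) (k := k) (n := k + r)
  obtain ⟨Q, hQ⟩ := tests_mem_Gab hk hr hs he
  have hrun : ∀ G : Matrix (Fin k) (Fin (k + r)) K, ((P.bind fun _ => Q).run (load G)) =
      Q.run (P.run (load G)).1 := fun G => Prog.run_bind _ _ _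
  refine ⟨P.bind fun _ => Q, fun G => ?_, fun G => ?_⟩
  · rw [hrun, (hQ _).1, ← (hP G).2, rowSpace_mem_Gab_iff hs (hP G).1]
    rfl
  · rw [Prog.cost_bind]
    refine (add_le_add (hPT G) (hQ _).2).trans ?_
    have hL : 1 ≤ Nat.log 2 (Fintype.card F) := Nat.log_pos one_lt_two Fintype.one_lt_card
    -- Since `m ≥ k + r ≥ 2`, `K` is larger than `F`; an element outside `F` is neither `0` nor `1`.
    obtain ⟨a, ha⟩ : ∃ a : K, a ∉ Set.range (algebraMap F K) := by
      by_contra! h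
      have := LinearEquiv.finrank_eq (LinearEquiv.ofBijective (Algebra.linearMap F K)
        ⟨(algebraMap F K).injective, h⟩)
      rw [Module.finrank_self] at this
      omega
    have hN := mul_le_of_computesRREF (a := a) (fun h => ha ⟨0, by rw [map_zero, h]⟩)
      (fun h => ha ⟨1, by rw [map_one, h]⟩) hP hPT
    generalize rrefCost K k (k + r) = N at hN ⊢
    generalize Nat.log 2 (Fintype.card F) = L at hL ⊢
    generalize Module.finrank F K = m at hkr hem ⊢
    rw [mul_add] at hN
    have hmN : N ≤ L * (m * N) := by
      rw [← mul_assoc]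
      exact Nat.le_mul_of_pos_left N (Nat.mul_pos hL (by omega))
    have hkk : k * k ≤ N := by omega
    have hkr' : k * r ≤ N := by omega
    have hr2 : L * r ^ 2 ≤ L * (m * N) := by
      rw [pow_two]
      exact Nat.mul_le_mul_left L (Nat.mul_le_mul (by omega)
        ((Nat.le_mul_of_pos_left r hk).trans hkr'))
    have hk2 : L * k ^ 2 ≤ L * (m * N) := by
      rw [pow_two]
      exact Nat.mul_le_mul_left L (hkk.trans (Nat.le_mul_of_pos_left N (by omega)))
    have hpow : k * r * (3 + e * (2 * L + 4)) ≤ 9 * (L * (m * N)) := by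
      calc k * r * (3 + e * (2 * L + 4)) ≤ N * (3 * (L * m) + m * (6 * L)) := by
            refine Nat.mul_le_mul hkr' (add_le_add ?_ (Nat.mul_le_mul hem.le (by omega)))
            exact Nat.le_mul_of_pos_right 3 (Nat.mul_pos hL (by omega))
        _ = 9 * (L * (m * N)) := by ring
    have e1 : 11 * L * r ^ 2 = 11 * (L * r ^ 2) := mul_assoc _ _ _
    have e2 : 11 * L * k ^ 2 = 11 * (L * k ^ 2) := mul_assoc _ _ _
    have e3 : 40 * L * (m * N) = 40 * (L * (m * N)) := mul_assoc _ _ _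
    -- The contributions are at most `1 + 3 + 9 + 4 + 11 + 11 = 39` times `L * (m * N)`.
    rw [e1, e2, e3]
    omega

end Main

end Gabidulin

theorem mainTheorem2 :
    ∃ C : ℕ, ∀ (F : Type*) (K : Type*) [Field F] [Fintype F] [Field K] [Finite K] [Algebra F K]
      (k r : ℕ) (hk : 0 < k) (hr : 0 < r) (_ : k + r ≤ Module.finrank F K)
      (s : ℤ) (_ : IsCoprime s (Module.finrank F K : ℤ)),
      (∀ X : Matrix (Fin k) (Fin r) K,
        (Gabidulin.codeOf X ∈ Gabidulin.Gab F K k (k + r) s ↔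
          Gabidulin.qRank F (fun j => Gabidulin.Phi F s X ⟨0, hk⟩ j) = r ∧
          Gabidulin.qRank F (fun i => Gabidulin.Phi F s X i ⟨0, hr⟩) = k ∧
          (Gabidulin.Phi F s X).rank = 1) ∧
        (Gabidulin.codeOf X ∈ Gabidulin.Gab F K k (k + r) s ↔
          Gabidulin.qRank F (Fin.cons 1 (fun j => X ⟨0, hk⟩ j) : Fin (r + 1) → K) = r + 1 ∧
          Gabidulin.qRank F (Fin.cons 1 (fun i => X i ⟨0, hr⟩) : Fin (k + 1) → K) = k + 1 ∧
          (Gabidulin.Phi F s X).rank = 1)) ∧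
      ∃ P : Gabidulin.Prog K (Gabidulin.Reg k (k + r)) Bool,
        Gabidulin.Decides P (Gabidulin.Gab F K k (k + r) s) ∧
        Gabidulin.CostAtMost P
          (C * Nat.log 2 (Fintype.card F) *
            (Module.finrank F K * Gabidulin.rrefCost K k (k + r))) := by
  refine ⟨40, fun F K _ _ _ _ _ k r hk hr hkr s hs => ⟨fun X => ?_,
    Gabidulin.exists_decides_Gab hk hr hkr hs⟩⟩
  have hσ := Gabidulin.fixesOnlyBase_theta (F := F) (K := K) hs
  simp only [Gabidulin.qRank_eq_iff_linearIndependent,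
    Gabidulin.linearIndependent_cons_one_iff hσ]
  exact ⟨Gabidulin.criterion_one hk hr hs X, Gabidulin.criterion_one hk hr hs X⟩
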